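/- **Theorem.** Let $n,p\ge 1$, $A\in\mathbb R^{n\times n}$, $B\in\mathbb R^{n\times p}$ with $(A,B)$ controllable, let $Q\in\mathbb R^{n\times n}$ and $R\in\mathbb R^{p\times p}$ be symmetric positive definite, and let $\sigma_w^2\ge 0$. Consider the system $$x_{k+1}=Ax_k+Bu_k+w_k,\qquad w_0,w_1,\dots\ \text{i.i.d. } \mathcal N(0,\sigma_w^2 I_n),$$ with $x_0$ independent of $(w_k)_{k\ge 0}$. A sequence of inputs is *admissible* if each $u_k$ is an $\mathbb R^p$-valued random variable that is independent of $\sigma(w_k,w_{k+1},\dots)$. Let $$J_\star=\inf\ \lim_{T\to\infty}\frac1T\,\mathbb E\Big[\sum_{k=1}^T x_k^\top Qx_k+u_k^\top Ru_k\Big],$$ the infimum being over admissible inputs for the system started at $x_0=0$ for which the limit exists. Let $P_\star$ be the positive semidefinite solution of the Riccati equation $$P_\star=A^\top P_\star A-A^\top P_\star B(R+B^\top P_\star B)^{-1}B^\top P_\star A+Q ,$$ let $K_\star=-(R+B^\top P_\star B)^{-1}B^\top P_\star A$ and $M=A+BK_\star$ be the optimal feedback and closed loop matrices, and let $P_\infty$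 be the positive semidefinite solution of $P_\infty=MP_\infty M^\top+\sigma_w^2 I_n$, so that $\mathcal N(0,P_\infty)$ is the stationary distribution of $x_{k+1}=Mx_k+w_k$. Then there are a positive integer $T_0$ and a real number $C_0>0$, depending only on $A,B,Q,R,\sigma_w^2$ and the dimensions, such that the following holds. Let $x_0\sim\mathcal N(0,P_\infty)$, let $(u_k)_{k\ge 0}$ be any admissible inputs, let $\delta\in[0,1]$, and let $f\colon\mathbb R\to\mathbb R$ be any function such that for every integer $T\ge 0$, with probability at least $1-\delta$, $$\lambda_{\min}\Big(\sum_{k=0}^{T-1}\begin{bmatrix}x_k\\u_k\end{bmatrix}\begin{bmatrix}x_k^\top&u_k^\top\end{bmatrix}\Big)\ge f(T).$$ Then for every integer $T\ge T_0$, $$\sum_{k=0}^{T}\mathbb E\big[x_k^\top Qx_k+u_k^\top Ru_k-J_\star\big]\ \ge\ \tfrac12(1-\delta)\,\lambda_{\min}(R)\,\big(1+\sigma_{\min}(K_\star)^2\big)\,f(T-T_0)-C_0 ,$$ where $\sigma_{\min}(K_\star)$ is the smallest of the $\min(n,p)$ singular values of $K_\star$, and the left-hand side is $+\infty$ if one of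 the expected costs is infinite. -/

import Mathlib

open MeasureTheory ProbabilityTheory Filter Topology Matrix
open scoped ENNReal

noncomputable section

/-- Smallest eigenvalue of a (nonempty) real symmetric matrix. -/
def lambdaMin {ι : Type*} [Fintype ι] [DecidableEq ι] (M : Matrix ι ι ℝ) : ℝ :=
  sInf (spectrum ℝ M)

/-- Smallest singular value of a real `p × n` matrix, i.e. the last of its `min n p` singular
values (Mathlib lists them in decreasing order, starting with index `0`). -/
def sigmaMin {n p : ℕ} (K : Matrix (Fin p) (Fin n) ℝ) : ℝ :=
  (Matrix.toEuclideanLin K).singularValues (min n p - 1)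

/-- Kalman's rank condition: the matrix `[B, A B, …, A ^ (n - 1) B]` has rank `n`. -/
def IsControllable {n p : ℕ} (A : Matrix (Fin n) (Fin n) ℝ) (B : Matrix (Fin n) (Fin p) ℝ) :
    Prop :=
  (Matrix.of fun (i : Fin n) (kj : Fin n × Fin p) => (A ^ (kj.1 : ℕ) * B) i kj.2).rank = n

/-- Data of a linear quadratic regulator problem: the dynamics `x⁺ = A x + B u + w` with
`w ∼ N(0, noiseVar • I)`, and the stage cost `xᵀ Q x + uᵀ R u`. -/
structure LQR (n p : ℕ) where
  A : Matrix (Fin n) (Fin n) ℝ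
  B : Matrix (Fin n) (Fin p) ℝ
  Q : Matrix (Fin n) (Fin n) ℝ
  R : Matrix (Fin p) (Fin p) ℝ
  /-- The noise variance `σ_w²`. -/
  noiseVar : ℝ

namespace LQR

variable {n p : ℕ}

/-- `P` is a positive semidefinite solution of the discrete algebraic Riccati equation. For
`Q, R` positive definite and `(A, B)` controllable there is exactly one. -/
def IsRiccatiSolution (S : LQR n p) (P : Matrix (Fin n) (Fin n) ℝ) : Prop :=
  P.PosSemidef ∧
    P = S.Aᵀ * P * S.A - S.Aᵀ * P * S.B * (S.R + S.Bᵀ * P * S.B)⁻¹ * S.Bᵀ * P * S.A + S.Q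

open Classical in
/-- The solution `P⋆` of the Riccati equation (with value `0` if there is none). -/
def Pstar (S : LQR n p) : Matrix (Fin n) (Fin n) ℝ :=
  if h : ∃ P, S.IsRiccatiSolution P then h.choose else 0

/-- The optimal feedback matrix `K⋆ = -(R + Bᵀ P⋆ B)⁻¹ Bᵀ P⋆ A`. -/
def Kstar (S : LQR n p) : Matrix (Fin p) (Fin n) ℝ :=
  -((S.R + S.Bᵀ * S.Pstar * S.B)⁻¹ * S.Bᵀ * S.Pstar * S.A)

/-- The optimal closed loop matrix `A + B K⋆`. -/
def closedLoop (S : LQR n p) : Matrix (Fin n) (Fin n) ℝ :=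
  S.A + S.B * S.Kstar

/-- `P` is a covariance matrix that is invariant under `x⁺ = (A + B K⋆) x + w`. As `A + B K⋆` is
stable under the standing assumptions, there is exactly one. -/
def IsStationaryCov (S : LQR n p) (P : Matrix (Fin n) (Fin n) ℝ) : Prop :=
  P.PosSemidef ∧
    P = S.closedLoop * P * S.closedLoopᵀ + S.noiseVar • (1 : Matrix (Fin n) (Fin n) ℝ)

open Classical in
/-- The stationary covariance `P∞` of the optimal closed loop (with value `0` if there is none). -/
def Pinf (S : LQR n p) : Matrix (Fin n) (Fin n) ℝ :=
  if h : ∃ P, S.IsStationaryCov P then h.choose else 0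

/-- The processes `x, u, w` on the probability space `(Ω, μ)` form a trajectory of the system with
initial law `ν` and admissible inputs: the noise is i.i.d. `N(0, noiseVar • I)` and independent of
the initial state, and each `u t` is a random vector independent of `σ(w t, w (t + 1), …)`. -/
structure IsTrajectory (S : LQR n p) {Ω : Type*} [MeasurableSpace Ω] (μ : Measure Ω)
    (ν : Measure (EuclideanSpace ℝ (Fin n)))
    (x : ℕ → Ω → EuclideanSpace ℝ (Fin n)) (u : ℕ → Ω → EuclideanSpace ℝ (Fin p))
    (w : ℕ → Ω → EuclideanSpace ℝ (Fin n)) : Prop where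
  measurable_init : Measurable (x 0)
  measurable_input : ∀ t, Measurable (u t)
  measurable_noise : ∀ t, Measurable (w t)
  law_init : μ.map (x 0) = ν
  law_noise : ∀ t, μ.map (w t) =
    multivariateGaussian 0 (S.noiseVar • (1 : Matrix (Fin n) (Fin n) ℝ))
  indep_noise : iIndepFun w μ
  indep_init : IndepFun (x 0) (fun ω (k : ℕ) => w k ω) μ
  indep_input : ∀ t, IndepFun (u t) (fun ω (k : ℕ) => w (t + k) ω) μ
  dynamics : ∀ t ω, (x (t + 1) ω).ofLp =
    S.A *ᵥ (x t ω).ofLp + S.B *ᵥ (u t ω).ofLp + (w t ω).ofLp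

/-- The stage cost `xᵀ Q x + uᵀ R u`. -/
def cost (S : LQR n p) (x : EuclideanSpace ℝ (Fin n)) (u : EuclideanSpace ℝ (Fin p)) : ℝ :=
  x.ofLp ⬝ᵥ (S.Q *ᵥ x.ofLp) + u.ofLp ⬝ᵥ (S.R *ᵥ u.ofLp)

/-- The expectation of the (nonnegative) stage cost; it is `∞` if the cost is not integrable. -/
def expectedCost (S : LQR n p) {Ω : Type*} [MeasurableSpace Ω] (μ : Measure Ω)
    (x : Ω → EuclideanSpace ℝ (Fin n)) (u : Ω → EuclideanSpace ℝ (Fin p)) : ℝ≥0∞ :=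
  ∫⁻ ω, ENNReal.ofReal (S.cost (x ω) (u ω)) ∂μ

/-- `c` is the infinite horizon average cost `lim_T (1 / T) E[∑_{k=1}^T x_kᵀ Q x_k + u_kᵀ R u_k]`
of some trajectory with `x_0 = 0` and admissible inputs, along which this limit exists. -/
def IsAverageCost (S : LQR n p) (c : ℝ≥0∞) : Prop :=
  ∃ (Ω : Type) (_ : MeasurableSpace Ω) (μ : Measure Ω) (_ : IsProbabilityMeasure μ)
    (x : ℕ → Ω → EuclideanSpace ℝ (Fin n)) (u : ℕ → Ω → EuclideanSpace ℝ (Fin p))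
    (w : ℕ → Ω → EuclideanSpace ℝ (Fin n)),
    S.IsTrajectory μ (Measure.dirac 0) x u w ∧
    Tendsto (fun T : ℕ => (∑ k ∈ Finset.Icc 1 T, S.expectedCost μ (x k) (u k)) / (T : ℝ≥0∞))
      atTop (𝓝 c)

/-- The optimal infinite horizon average cost `J⋆`. -/
def Jstar (S : LQR n p) : ℝ≥0∞ :=
  sInf {c | S.IsAverageCost c}

/-- `∑_{k=0}^T E[x_kᵀ Q x_k + u_kᵀ R u_k - J⋆]`, an extended real number, since the expected cost
of a general admissible input may be infinite. -/
def expectedRegret (S : LQR n p) {Ω : Type*} [MeasurableSpace Ω] (μ : Measure Ω)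
    (x : ℕ → Ω → EuclideanSpace ℝ (Fin n)) (u : ℕ → Ω → EuclideanSpace ℝ (Fin p)) (T : ℕ) :
    EReal :=
  ∑ k ∈ Finset.range (T + 1), ((S.expectedCost μ (x k) (u k) : EReal) - (S.Jstar : EReal))

end LQR

/-- The empirical covariance `∑_{k=0}^{T-1} [x_k; u_k] [x_k; u_k]ᵀ` at the outcome `ω`. -/
def empiricalCov {n p : ℕ} {Ω : Type*} (x : ℕ → Ω → EuclideanSpace ℝ (Fin n))
    (u : ℕ → Ω → EuclideanSpace ℝ (Fin p)) (T : ℕ) (ω : Ω) :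
    Matrix (Fin n ⊕ Fin p) (Fin n ⊕ Fin p) ℝ :=
  ∑ k ∈ Finset.range T,
    Matrix.vecMulVec (Sum.elim (x k ω).ofLp (u k ω).ofLp) (Sum.elim (x k ω).ofLp (u k ω).ofLp)

end

/-! Write V_k for the expectation of x_kᵀ P⋆ x_k, g_k for the expected squared deviation of u_k from
K⋆ x_k in the norm of R + Bᵀ P⋆ B, and s = σ_w² tr P⋆. Completing the square in the Bellman equation
(`bellman_identity`) and averaging over the noise gives E cost_k = V_k - V_{k+1} + g_k + s. The
optimal feedback has average cost s, so J⋆ ≤ s (`Jstar_le`), and the regret is at least V_0 -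
V_{T+1} + ∑ g_k.

The terminal value V_{T+1} must not consume the deviations. As Q and R are positive definite, the
stage cost dominates c times the value of the noiseless successor (`exists_contraction`), whence (1
+ c)(V_{k+1} - s) ≤ V_k + g_k. By Grönwall, V_{T+1} is at most V_0 plus a constant plus a sum of the
g_k with geometrically decaying weights. V_0 cancels, and deviations older than T₀ steps survive
with weight at least 1/2 (`half_sum_le_of_contraction_recursion`).

Finally, small deviations mean poor excitation: the empirical covariance tested on the rows of [-K⋆,
I] is the sum of squares of u - K⋆ x (`lambdaMin_empiricalCov_mul_le`). Markov's inequality turns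
the bound in probability into a bound on ∑ g_k.

Admissibility makes each input separately independent of the future noise, not jointly with the
state. The argument therefore uses only correlations with the noise, which are linear. -/

/-! ### Quadratic forms and the smallest eigenvalue -/

theorem dotProduct_transpose_mul_mulVec {m n l : Type*} [Fintype m] [Fintype n] [Fintype l]
    (A : Matrix m n ℝ) (N : Matrix m l ℝ) (x : n → ℝ) (y : l → ℝ) :
    x ⬝ᵥ (Aᵀ * N) *ᵥ y = (A *ᵥ x) ⬝ᵥ N *ᵥ y := by
  rw [← mulVec_mulVec, dotProduct_mulVec, vecMul_transpose]

theorem Matrix.PosSemidef.dotProduct_mulVec_comm {n : Type*} [Fintype n] {P : Matrix n n ℝ}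
    (hP : P.PosSemidef) (x y : n → ℝ) : x ⬝ᵥ P *ᵥ y = y ⬝ᵥ P *ᵥ x := by
  have h : Pᵀ = P := by simpa [IsHermitian] using hP.1
  rw [dotProduct_mulVec, ← mulVec_transpose, h, dotProduct_comm]

theorem Matrix.PosSemidef.quad_nonneg {n : Type*} [Fintype n] {P : Matrix n n ℝ}
    (hP : P.PosSemidef) (x : n → ℝ) : 0 ≤ x ⬝ᵥ P *ᵥ x := by
  simpa using hP.dotProduct_mulVec_nonneg x

theorem Matrix.PosDef.quad_pos {n : Type*} [Fintype n] {P : Matrix n n ℝ}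
    (hP : P.PosDef) {x : n → ℝ} (hx : x ≠ 0) : 0 < x ⬝ᵥ P *ᵥ x := by
  simpa using hP.dotProduct_mulVec_pos hx

theorem posSemidef_of_quad_nonneg {n : Type*} [Fintype n] {P : Matrix n n ℝ}
    (hP : Pᵀ = P) (h : ∀ x : n → ℝ, 0 ≤ x ⬝ᵥ P *ᵥ x) : P.PosSemidef := by
  refine PosSemidef.of_dotProduct_mulVec_nonneg ?_ fun x => ?_
  · simpa [IsHermitian] using hP
  · simpa using h x

/-- A positive semidefinite form is bounded by `lambdaMin` from below. -/
theorem lambdaMin_mul_le_quad {ι : Type*} [Fintype ι] [DecidableEq ι] {M : Matrix ι ι ℝ}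
    (hM : M.PosSemidef) (v : ι → ℝ) : lambdaMin M * (v ⬝ᵥ v) ≤ v ⬝ᵥ M *ᵥ v := by
  have h : (M - algebraMap ℝ _ (lambdaMin M)).PosSemidef := by
    rw [posSemidef_iff_isHermitian_and_spectrum_nonneg]
    refine ⟨hM.1.sub ?_, ?_⟩
    · rw [algebraMap_eq_diagonal]
      exact isHermitian_diagonal _
    · rw [← spectrum.sub_singleton_eq]
      rintro _ ⟨a, ha, b, rfl, rfl⟩
      have : BddBelow (spectrum ℝ M) :=
        ⟨0, fun y hy => (posSemidef_iff_isHermitian_and_spectrum_nonneg.1 hM).2 hy⟩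
      exact sub_nonneg.2 (csInf_le this ha)
  have h2 := h.quad_nonneg v
  rw [sub_mulVec, dotProduct_sub, Algebra.algebraMap_eq_smul_one, smul_mulVec, one_mulVec,
    dotProduct_smul, smul_eq_mul] at h2
  linarith

theorem lambdaMin_nonneg {ι : Type*} [Fintype ι] [DecidableEq ι] {M : Matrix ι ι ℝ}
    (hM : M.PosSemidef) : 0 ≤ lambdaMin M :=
  Real.sInf_nonneg fun _ hy => (posSemidef_iff_isHermitian_and_spectrum_nonneg.1 hM).2 hy

/-- Positive definite forms dominate positive multiples of arbitrary forms. -/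
theorem exists_pos_mul_quad_le {n : Type*} [Fintype n] (N : Matrix n n ℝ)
    {M : Matrix n n ℝ} (hM : M.PosDef) :
    ∃ c > 0, ∀ x : n → ℝ, c * (x ⬝ᵥ N *ᵥ x) ≤ x ⬝ᵥ M *ᵥ x := by
  have hc (N : Matrix n n ℝ) : Continuous fun x : n → ℝ => x ⬝ᵥ N *ᵥ x := by
    simp only [dotProduct, mulVec]; fun_prop
  obtain ⟨a, ha0, ha⟩ : ∃ a > 0, ∀ x ∈ Metric.sphere (0 : n → ℝ) 1, x ⬝ᵥ N *ᵥ x ≤ a := by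
    obtain ⟨a, ha⟩ := ((isCompact_sphere (0 : n → ℝ) 1).image (hc N)).bddAbove
    -- The maximum with 1 allows division by the bound even if the form of `N` is nowhere positive.
    exact ⟨max a 1, by positivity, fun x hx => (ha ⟨x, hx, rfl⟩).trans (le_max_left _ _)⟩
  obtain ⟨b, hb0, hb⟩ : ∃ b > 0, ∀ x ∈ Metric.sphere (0 : n → ℝ) 1, b ≤ x ⬝ᵥ M *ᵥ x := by
    rcases (Metric.sphere (0 : n → ℝ) 1).eq_empty_or_nonempty with h | h
    · exact ⟨1, one_pos, by simp [h]⟩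
    · obtain ⟨y, hy, hmin⟩ := (isCompact_sphere (0 : n → ℝ) 1).exists_isMinOn h (hc M).continuousOn
      refine ⟨_, hM.quad_pos (x := y) ?_, fun x hx => hmin hx⟩
      rintro rfl; simp at hy
  refine ⟨b / a, by positivity, fun x => ?_⟩
  rcases eq_or_ne x 0 with rfl | hx
  · simp
  have hx' : 0 < ‖x‖ := norm_pos_iff.2 hx
  have hy : ‖x‖⁻¹ • x ∈ Metric.sphere (0 : n → ℝ) 1 := by
    simp [norm_smul, hx'.ne']
  have h1 := ha _ hy
  have h2 := hb _ hy
  simp only [mulVec_smul, dotProduct_smul, smul_dotProduct, smul_eq_mul, ← mul_assoc] at h1 h2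
  have h3 : 0 < ‖x‖⁻¹ * ‖x‖⁻¹ := by positivity
  rw [div_mul_eq_mul_div, div_le_iff₀ ha0]
  refine le_of_mul_le_mul_left ?_ h3
  nlinarith [mul_le_mul_of_nonneg_left h1 hb0.le, mul_le_mul_of_nonneg_right h2 ha0.le]

/-! ### Bellman equation, value iteration and the Riccati solution -/

namespace LQR

variable {n p : ℕ}

/-- The curvature `R + Bᵀ P B` of the Bellman operator. -/
noncomputable def inputWeight (S : LQR n p) (P : Matrix (Fin n) (Fin n) ℝ) :
    Matrix (Fin p) (Fin p) ℝ :=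
  S.R + S.Bᵀ * P * S.B

/-- The feedback that is greedy for the cost-to-go `P`. -/
noncomputable def gain (S : LQR n p) (P : Matrix (Fin n) (Fin n) ℝ) :
    Matrix (Fin p) (Fin n) ℝ :=
  -((S.R + S.Bᵀ * P * S.B)⁻¹ * S.Bᵀ * P * S.A)

/-- The Riccati operator. -/
noncomputable def riccati (S : LQR n p) (P : Matrix (Fin n) (Fin n) ℝ) :
    Matrix (Fin n) (Fin n) ℝ :=
  S.Aᵀ * P * S.A - S.Aᵀ * P * S.B * (S.R + S.Bᵀ * P * S.B)⁻¹ * S.Bᵀ * P * S.A + S.Q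

theorem inputWeight_posDef {S : LQR n p} (hR : S.R.PosDef) {P : Matrix (Fin n) (Fin n) ℝ}
    (hP : P.PosSemidef) : (S.inputWeight P).PosDef := by
  refine hR.add_posSemidef ?_
  simpa using hP.conjTranspose_mul_mul_same S.B

theorem quad_le_quad_inputWeight (S : LQR n p) {P : Matrix (Fin n) (Fin n) ℝ}
    (hP : P.PosSemidef) (v : Fin p → ℝ) : v ⬝ᵥ S.R *ᵥ v ≤ v ⬝ᵥ S.inputWeight P *ᵥ v := by
  rw [inputWeight, add_mulVec, dotProduct_add, Matrix.mul_assoc, dotProduct_transpose_mul_mulVec,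
    ← mulVec_mulVec]
  linarith [hP.quad_nonneg (S.B *ᵥ v)]

/-- Completion of squares in the Bellman equation. -/
theorem bellman_identity {S : LQR n p} (hR : S.R.PosDef) {P : Matrix (Fin n) (Fin n) ℝ}
    (hP : P.PosSemidef) (x : Fin n → ℝ) (u : Fin p → ℝ) :
    x ⬝ᵥ S.Q *ᵥ x + u ⬝ᵥ S.R *ᵥ u + (S.A *ᵥ x + S.B *ᵥ u) ⬝ᵥ P *ᵥ (S.A *ᵥ x + S.B *ᵥ u) =
      x ⬝ᵥ S.riccati P *ᵥ x +
        (u - S.gain P *ᵥ x) ⬝ᵥ S.inputWeight P *ᵥ (u - S.gain P *ᵥ x) := by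
  have hW := inputWeight_posDef hR hP
  have hdet : IsUnit (S.inputWeight P).det := hW.det_pos.ne'.isUnit
  -- Normal equation of the minimisation over `u`; it makes the cross terms cancel.
  have hK : S.inputWeight P * S.gain P = -(S.Bᵀ * (P * S.A)) := by
    rw [gain, ← inputWeight, Matrix.mul_neg]
    simp only [Matrix.mul_assoc]
    rw [mul_nonsing_inv_cancel_left _ _ hdet]
  have hWK (v : Fin p → ℝ) :
      v ⬝ᵥ S.inputWeight P *ᵥ (S.gain P *ᵥ x) = -((S.B *ᵥ v) ⬝ᵥ P *ᵥ (S.A *ᵥ x)) := by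
    rw [mulVec_mulVec, hK, neg_mulVec, dotProduct_neg, dotProduct_transpose_mul_mulVec,
      mulVec_mulVec]
  have hric : x ⬝ᵥ S.riccati P *ᵥ x = (S.A *ᵥ x) ⬝ᵥ P *ᵥ (S.A *ᵥ x) +
      (S.A *ᵥ x) ⬝ᵥ P *ᵥ (S.B *ᵥ (S.gain P *ᵥ x)) + x ⬝ᵥ S.Q *ᵥ x := by
    have : S.riccati P = S.Aᵀ * (P * S.A) + S.Aᵀ * (P * (S.B * S.gain P)) + S.Q := by
      simp only [riccati, gain, Matrix.mul_neg, ← sub_eq_add_neg, Matrix.mul_assoc]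
    rw [this, add_mulVec, add_mulVec, dotProduct_add, dotProduct_add,
      dotProduct_transpose_mul_mulVec, dotProduct_transpose_mul_mulVec]
    simp only [mulVec_mulVec]
  have huu : u ⬝ᵥ S.inputWeight P *ᵥ u = u ⬝ᵥ S.R *ᵥ u + (S.B *ᵥ u) ⬝ᵥ P *ᵥ (S.B *ᵥ u) := by
    rw [inputWeight, add_mulVec, dotProduct_add, Matrix.mul_assoc, dotProduct_transpose_mul_mulVec,
      ← mulVec_mulVec]
  simp only [mulVec_add, mulVec_sub, dotProduct_add, dotProduct_sub, add_dotProduct,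
    sub_dotProduct, hWK, hric, huu]
  rw [hW.posSemidef.dotProduct_mulVec_comm _ u, hWK,
    hP.dotProduct_mulVec_comm (S.A *ᵥ x) (S.B *ᵥ u),
    hP.dotProduct_mulVec_comm (S.A *ᵥ x) (S.B *ᵥ (S.gain P *ᵥ x))]
  ring

/-- The square in `bellman_identity` is nonnegative, and it vanishes for the greedy input
(`riccati_eq`). So the Riccati operator is a minimum over inputs, the form in which it is used
below. -/
theorem riccati_le {S : LQR n p} (hR : S.R.PosDef) {P : Matrix (Fin n) (Fin n) ℝ}
    (hP : P.PosSemidef) (x : Fin n → ℝ) (u : Fin p → ℝ) :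
    x ⬝ᵥ S.riccati P *ᵥ x ≤ x ⬝ᵥ S.Q *ᵥ x + u ⬝ᵥ S.R *ᵥ u +
      (S.A *ᵥ x + S.B *ᵥ u) ⬝ᵥ P *ᵥ (S.A *ᵥ x + S.B *ᵥ u) := by
  rw [bellman_identity hR hP]
  linarith [(inputWeight_posDef hR hP).posSemidef.quad_nonneg (u - S.gain P *ᵥ x)]

theorem riccati_eq {S : LQR n p} (hR : S.R.PosDef) {P : Matrix (Fin n) (Fin n) ℝ}
    (hP : P.PosSemidef) (x : Fin n → ℝ) :
    x ⬝ᵥ S.riccati P *ᵥ x = x ⬝ᵥ S.Q *ᵥ x + (S.gain P *ᵥ x) ⬝ᵥ S.R *ᵥ (S.gain P *ᵥ x) +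
      (S.A *ᵥ x + S.B *ᵥ S.gain P *ᵥ x) ⬝ᵥ P *ᵥ (S.A *ᵥ x + S.B *ᵥ S.gain P *ᵥ x) := by
  rw [bellman_identity hR hP]
  simp

theorem riccati_posSemidef {S : LQR n p} (hQ : S.Q.PosDef) (hR : S.R.PosDef)
    {P : Matrix (Fin n) (Fin n) ℝ} (hP : P.PosSemidef) : (S.riccati P).PosSemidef := by
  have hPt : Pᵀ = P := by simpa [IsHermitian] using hP.1
  have hQt : S.Qᵀ = S.Q := by simpa [IsHermitian] using hQ.1
  have hRt : S.Rᵀ = S.R := by simpa [IsHermitian] using hR.1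
  refine posSemidef_of_quad_nonneg ?_ fun x => ?_
  · simp only [riccati, transpose_add, transpose_sub, transpose_mul, transpose_transpose,
      transpose_nonsing_inv, hPt, hQt, hRt, Matrix.mul_assoc]
  · rw [riccati_eq hR hP]
    have h1 := hQ.posSemidef.quad_nonneg x
    have h2 := hR.posSemidef.quad_nonneg (S.gain P *ᵥ x)
    have h3 := hP.quad_nonneg (S.A *ᵥ x + S.B *ᵥ S.gain P *ᵥ x)
    linarith

/-- The minimiser for `P'` is a competitor in the minimum for `P`. -/
theorem riccati_mono {S : LQR n p} (hR : S.R.PosDef) {P P' : Matrix (Fin n) (Fin n) ℝ}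
    (hP : P.PosSemidef) (hP' : P'.PosSemidef)
    (h : ∀ x : Fin n → ℝ, x ⬝ᵥ P *ᵥ x ≤ x ⬝ᵥ P' *ᵥ x) (x : Fin n → ℝ) :
    x ⬝ᵥ S.riccati P *ᵥ x ≤ x ⬝ᵥ S.riccati P' *ᵥ x := by
  rw [riccati_eq hR hP']
  refine (riccati_le hR hP x (S.gain P' *ᵥ x)).trans ?_
  linarith [h (S.A *ᵥ x + S.B *ᵥ S.gain P' *ᵥ x)]

/-- Value iteration: the optimal costs-to-go over horizons `0, 1, 2, …`. -/
noncomputable def valueIter (S : LQR n p) (T : ℕ) : Matrix (Fin n) (Fin n) ℝ :=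
  S.riccati^[T] 0

theorem valueIter_succ (S : LQR n p) (T : ℕ) :
    S.valueIter (T + 1) = S.riccati (S.valueIter T) :=
  Function.iterate_succ_apply' _ _ _

theorem valueIter_posSemidef {S : LQR n p} (hQ : S.Q.PosDef) (hR : S.R.PosDef) (T : ℕ) :
    (S.valueIter T).PosSemidef := by
  induction T with
  | zero => exact PosSemidef.zero
  | succ T ih => rw [valueIter_succ]; exact riccati_posSemidef hQ hR ih

theorem valueIter_quad_mono {S : LQR n p} (hQ : S.Q.PosDef) (hR : S.R.PosDef)
    (x : Fin n → ℝ) : Monotone fun T => x ⬝ᵥ S.valueIter T *ᵥ x := by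
  refine monotone_nat_of_le_succ fun T => ?_
  induction T generalizing x with
  | zero =>
    simpa [valueIter] using (valueIter_posSemidef hQ hR 1).quad_nonneg x
  | succ T ih =>
    rw [valueIter_succ, valueIter_succ S (T + 1)]
    exact riccati_mono hR (valueIter_posSemidef hQ hR T) (valueIter_posSemidef hQ hR _) ih x

/-- One step costs a finite amount, so boundedness passes from a successor state back to `x`.
Monotonicity in the horizon absorbs the shift from `T` to `T + 1`. -/
theorem valueIter_bddAbove_of_step {S : LQR n p} (hQ : S.Q.PosDef) (hR : S.R.PosDef)
    (x : Fin n → ℝ) (u : Fin p → ℝ)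
    (h : BddAbove (Set.range fun T => (S.A *ᵥ x + S.B *ᵥ u) ⬝ᵥ S.valueIter T *ᵥ
      (S.A *ᵥ x + S.B *ᵥ u))) :
    BddAbove (Set.range fun T => x ⬝ᵥ S.valueIter T *ᵥ x) := by
  obtain ⟨c, hc⟩ := h
  refine ⟨x ⬝ᵥ S.Q *ᵥ x + u ⬝ᵥ S.R *ᵥ u + c, ?_⟩
  rintro _ ⟨T, rfl⟩
  refine (valueIter_quad_mono hQ hR x T.le_succ).trans ?_
  rw [Nat.succ_eq_add_one]
  dsimp only
  rw [valueIter_succ]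
  have := hc ⟨T, rfl⟩
  linarith [riccati_le hR (valueIter_posSemidef hQ hR T) x u]

/-- A state that can be driven to 0 has bounded cost-to-go, since resting at 0 is free. Inputs are
numbered backwards in time: with `k + 1` steps left, `u k` is applied first. -/
theorem valueIter_bddAbove_of_reach {S : LQR n p} (hQ : S.Q.PosDef) (hR : S.R.PosDef)
    (u : ℕ → Fin p → ℝ) (k : ℕ) (x : Fin n → ℝ)
    (h : S.A ^ k *ᵥ x + ∑ j ∈ Finset.range k, (S.A ^ j * S.B) *ᵥ u j = 0) :
    BddAbove (Set.range fun T => x ⬝ᵥ S.valueIter T *ᵥ x) := by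
  induction k generalizing x with
  | zero =>
    obtain rfl : x = 0 := by simpa using h
    exact ⟨0, by rintro _ ⟨T, rfl⟩; simp⟩
  | succ k ih =>
    refine valueIter_bddAbove_of_step hQ hR x (u k) (ih _ ?_)
    rw [← h, Finset.sum_range_succ, mulVec_add, mulVec_mulVec, mulVec_mulVec, pow_succ]
    abel

theorem exists_steering {S : LQR n p} (hAB : IsControllable S.A S.B) (y : Fin n → ℝ) :
    ∃ u : ℕ → Fin p → ℝ, ∑ j ∈ Finset.range n, (S.A ^ j * S.B) *ᵥ u j = y := by
  set C : Matrix (Fin n) (Fin n × Fin p) ℝ :=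
    Matrix.of fun (i : Fin n) (kj : Fin n × Fin p) => (S.A ^ (kj.1 : ℕ) * S.B) i kj.2 with hC
  have hsurj : Function.Surjective C.mulVecLin := by
    rw [← LinearMap.range_eq_top]
    apply Submodule.eq_top_of_finrank_eq
    rw [Module.finrank_fin_fun]
    exact hAB
  obtain ⟨v, hv⟩ := hsurj y
  refine ⟨fun j i => if h : j < n then v (⟨j, h⟩, i) else 0, ?_⟩
  rw [← hv, Finset.sum_range]
  ext i
  simp [mulVec, dotProduct, Fintype.sum_prod_type, hC]

theorem valueIter_bddAbove {S : LQR n p} (hQ : S.Q.PosDef) (hR : S.R.PosDef)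
    (hAB : IsControllable S.A S.B) (x : Fin n → ℝ) :
    BddAbove (Set.range fun T => x ⬝ᵥ S.valueIter T *ᵥ x) := by
  obtain ⟨u, hu⟩ := exists_steering hAB (-(S.A ^ n *ᵥ x))
  exact valueIter_bddAbove_of_reach hQ hR u n x (by rw [hu]; simp)

/-- The Riccati equation has a positive semidefinite solution. -/
theorem exists_isRiccatiSolution {S : LQR n p} (hQ : S.Q.PosDef) (hR : S.R.PosDef)
    (hAB : IsControllable S.A S.B) : ∃ P, S.IsRiccatiSolution P := by
  have hq (x : Fin n → ℝ) : ∃ a, Tendsto (fun T => x ⬝ᵥ S.valueIter T *ᵥ x) atTop (𝓝 a) :=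
    ⟨_, tendsto_atTop_ciSup (valueIter_quad_mono hQ hR x) (valueIter_bddAbove hQ hR hAB x)⟩
  choose a ha using hq
  -- Polarisation: entries are combinations of values of the form, so convergence on each vector
  -- gives convergence of the matrices.
  have hpol (T : ℕ) (i j : Fin n) : S.valueIter T i j =
      ((Pi.single i 1 + Pi.single j 1) ⬝ᵥ S.valueIter T *ᵥ (Pi.single i 1 + Pi.single j 1) -
        Pi.single i 1 ⬝ᵥ S.valueIter T *ᵥ Pi.single i 1 -
        Pi.single j 1 ⬝ᵥ S.valueIter T *ᵥ Pi.single j 1) / 2 := by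
    have h := (valueIter_posSemidef hQ hR T).dotProduct_mulVec_comm (Pi.single i 1) (Pi.single j 1)
    simp only [mulVec_add, dotProduct_add, add_dotProduct]
    rw [← h]
    simp
    ring
  set P : Matrix (Fin n) (Fin n) ℝ := fun i j =>
    (a (Pi.single i 1 + Pi.single j 1) - a (Pi.single i 1) - a (Pi.single j 1)) / 2
  have hP : Tendsto S.valueIter atTop (𝓝 P) := by
    refine tendsto_pi_nhds.2 fun i => tendsto_pi_nhds.2 fun j => ?_
    simp only [hpol]
    exact (((ha _).sub (ha _)).sub (ha _)).div_const 2
  have hpsd : P.PosSemidef := by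
    refine posSemidef_of_quad_nonneg ?_ fun x => ?_
    · refine tendsto_nhds_unique ((continuous_id.matrix_transpose.tendsto P).comp hP)
        (hP.congr fun T => ?_)
      simpa [IsHermitian] using (valueIter_posSemidef hQ hR T).1.symm
    · have hc : Continuous fun N : Matrix (Fin n) (Fin n) ℝ => x ⬝ᵥ N *ᵥ x := by fun_prop
      exact ge_of_tendsto' ((hc.tendsto P).comp hP)
        fun T => (valueIter_posSemidef hQ hR T).quad_nonneg x
  refine ⟨P, hpsd, ?_⟩
  have hdet : (S.R + S.Bᵀ * P * S.B).det ≠ 0 := (inputWeight_posDef hR hpsd).det_pos.ne'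
  have hcont : ContinuousAt S.riccati P := by
    have hinv : ContinuousAt (fun P => (S.R + S.Bᵀ * P * S.B)⁻¹) P := by
      refine ContinuousAt.comp (f := fun P => S.R + S.Bᵀ * P * S.B) (g := fun N => N⁻¹) ?_
        (by fun_prop)
      refine continuousAt_matrix_inv _ ?_
      simpa using NormedRing.inverse_continuousAt (Units.mk0 _ hdet)
    unfold riccati
    fun_prop
  refine tendsto_nhds_unique ((tendsto_add_atTop_iff_nat 1).2 hP) ?_
  simp only [valueIter_succ]
  exact hcont.tendsto.comp hP

theorem isRiccatiSolution_Pstar {S : LQR n p} (hQ : S.Q.PosDef) (hR : S.R.PosDef)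
    (hAB : IsControllable S.A S.B) : S.IsRiccatiSolution S.Pstar := by
  have h := exists_isRiccatiSolution hQ hR hAB
  rw [Pstar, dif_pos h]
  exact h.choose_spec

/-- The factor 1/2 in the constant pays for the cross term, since the form of `P` at a sum is at
most twice the sum of its values at the summands. -/
theorem exists_contraction {S : LQR n p} (hQ : S.Q.PosDef) (hR : S.R.PosDef)
    {P : Matrix (Fin n) (Fin n) ℝ} (hP : P.PosSemidef) :
    ∃ c > 0, ∀ (x : Fin n → ℝ) (u : Fin p → ℝ),
      c * ((S.A *ᵥ x + S.B *ᵥ u) ⬝ᵥ P *ᵥ (S.A *ᵥ x + S.B *ᵥ u)) ≤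
        x ⬝ᵥ S.Q *ᵥ x + u ⬝ᵥ S.R *ᵥ u := by
  obtain ⟨c, hc, h1⟩ := exists_pos_mul_quad_le (S.Aᵀ * (P * S.A)) hQ
  obtain ⟨d, hd, h2⟩ := exists_pos_mul_quad_le (S.Bᵀ * (P * S.B)) hR
  refine ⟨min c d / 2, by positivity, fun x u => ?_⟩
  have h1 := h1 x
  have h2 := h2 u
  rw [dotProduct_transpose_mul_mulVec, ← mulVec_mulVec] at h1 h2
  have h3 := hP.quad_nonneg (S.A *ᵥ x - S.B *ᵥ u)
  have h4 := hP.quad_nonneg (S.A *ᵥ x)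
  have h5 := hP.quad_nonneg (S.B *ᵥ u)
  simp only [mulVec_add, mulVec_sub, dotProduct_add, dotProduct_sub, add_dotProduct,
    sub_dotProduct] at h3 ⊢
  have hm : 0 < min c d := lt_min hc hd
  have h6 := mul_le_mul_of_nonneg_right (min_le_left c d) h4
  have h7 := mul_le_mul_of_nonneg_right (min_le_right c d) h5
  nlinarith [mul_nonneg hm.le h3]

end LQR

/-! ### Singular values and excitation of the data -/

theorem mulVec_dotProduct_self_le {m n : Type*} [Fintype m] [Fintype n] (K : Matrix m n ℝ)
    (v : n → ℝ) : (K *ᵥ v) ⬝ᵥ (K *ᵥ v) ≤ (∑ i, ∑ j, K i j ^ 2) * (v ⬝ᵥ v) := by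
  rw [Finset.sum_mul]
  refine Finset.sum_le_sum fun i _ => ?_
  have h := Finset.sum_mul_sq_le_sq_mul_sq Finset.univ (K i) v
  simpa only [mulVec, dotProduct, sq] using h

/-- The square of a singular value is an eigenvalue of KᵀK; the Frobenius bound is applied to an
eigenvector. -/
theorem sigmaMin_sq_le {n p : ℕ} (hn : 0 < n) (K : Matrix (Fin p) (Fin n) ℝ) :
    sigmaMin K ^ 2 ≤ ∑ i, ∑ j, K i j ^ 2 := by
  set L := Matrix.toEuclideanLin K
  have hlt : min n p - 1 < Module.finrank ℝ (EuclideanSpace ℝ (Fin n)) := by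
    rw [finrank_euclideanSpace_fin]
    omega
  obtain ⟨v, hv⟩ := (L.hasEigenvalue_adjoint_comp_self_sq_singularValues hlt).exists_hasEigenvector
  have h1 : inner ℝ v ((LinearMap.adjoint L ∘ₗ L) v) = inner ℝ (L v) (L v) := by
    rw [LinearMap.comp_apply, LinearMap.adjoint_inner_right]
  rw [hv.apply_eq_smul, inner_smul_right] at h1
  have h2 : inner ℝ (L v) (L v) ≤ (∑ i, ∑ j, K i j ^ 2) * inner ℝ v v := by
    simp only [EuclideanSpace.inner_eq_star_dotProduct, star_trivial]
    exact mulVec_dotProduct_self_le K v.ofLp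
  have hpos : 0 < inner ℝ v v := real_inner_self_pos.2 hv.2
  exact le_of_mul_le_mul_right (h1.trans_le h2) hpos

theorem quad_sum_vecMulVec {ι : Type*} [Fintype ι] (z : ℕ → ι → ℝ) (N : ℕ) (v : ι → ℝ) :
    v ⬝ᵥ (∑ k ∈ Finset.range N, vecMulVec (z k) (z k)) *ᵥ v =
      ∑ k ∈ Finset.range N, (z k ⬝ᵥ v) ^ 2 := by
  rw [sum_mulVec, dotProduct_sum]
  refine Finset.sum_congr rfl fun k _ => ?_
  rw [vecMulVec_mulVec, op_smul_eq_smul, dotProduct_smul, smul_eq_mul, dotProduct_comm v, sq]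

/-- Deviations from a linear feedback are at least as large as the excitation of the data. -/
theorem lambdaMin_empiricalCov_mul_le {n p : ℕ} {Ω : Type*}
    (x : ℕ → Ω → EuclideanSpace ℝ (Fin n)) (u : ℕ → Ω → EuclideanSpace ℝ (Fin p)) (N : ℕ) (ω : Ω)
    (K : Matrix (Fin p) (Fin n) ℝ) :
    lambdaMin (empiricalCov x u N ω) * (p + ∑ i, ∑ j, K i j ^ 2) ≤
      ∑ k ∈ Finset.range N, ((u k ω).ofLp - K *ᵥ (x k ω).ofLp) ⬝ᵥ
        ((u k ω).ofLp - K *ᵥ (x k ω).ofLp) := by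
  have hpsd : (empiricalCov x u N ω).PosSemidef := by
    refine posSemidef_of_quad_nonneg ?_ fun v => ?_
    · simp [empiricalCov, transpose_sum, transpose_vecMulVec]
    · rw [empiricalCov, quad_sum_vecMulVec fun k => Sum.elim (x k ω).ofLp (u k ω).ofLp]
      positivity
  have h (i : Fin p) : lambdaMin (empiricalCov x u N ω) * (1 + ∑ j, K i j ^ 2) ≤
      ∑ k ∈ Finset.range N, ((u k ω).ofLp - K *ᵥ (x k ω).ofLp) i ^ 2 := by
    -- This vector pairs with (x, u) to the `i`-th coordinate of u - K x, and its squared length is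
    -- 1 + ∑ j, K i j ^ 2.
    have h := lambdaMin_mul_le_quad hpsd (Sum.elim (-(K i)) (Pi.single i 1))
    rw [empiricalCov, quad_sum_vecMulVec fun k => Sum.elim (x k ω).ofLp (u k ω).ofLp,
      ← empiricalCov, sumElim_dotProduct_sumElim] at h
    convert h using 2
    · simp [dotProduct, sq, add_comm, Pi.single_apply]
    · rw [sumElim_dotProduct_sumElim]
      simp [mulVec, dotProduct_comm (K i)]
      ring
  calc _ = ∑ i : Fin p, lambdaMin (empiricalCov x u N ω) * (1 + ∑ j, K i j ^ 2) := by
        rw [← Finset.mul_sum, Finset.sum_add_distrib]; simp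
    _ ≤ _ := Finset.sum_le_sum fun i _ => h i
    _ = _ := by
        rw [Finset.sum_comm]
        simp [dotProduct, sq]

/-! ### Recursive inequalities -/

/-- A discrete Grönwall inequality. -/
theorem le_of_contraction_recursion {a g : ℕ → ℝ} {c s : ℝ} (hc : 0 < c) {T : ℕ}
    (ha : 0 ≤ a 0) (hs : 0 ≤ s)
    (h : ∀ k < T, (1 + c) * (a (k + 1) - s) ≤ a k + g k) :
    a T ≤ a 0 + s * (1 + c) / c + ∑ k ∈ Finset.range T, (1 + c)⁻¹ ^ (T - k) * g k := by
  have hc' : 0 < 1 + c := by positivity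
  have key (m : ℕ) (hm : m ≤ T) : a m ≤ (1 + c)⁻¹ ^ m * a 0 + s * (1 + c) / c +
      ∑ k ∈ Finset.range m, (1 + c)⁻¹ ^ (m - k) * g k := by
    induction m with
    | zero => simpa using (by positivity : 0 ≤ s * (1 + c) / c)
    | succ m ih =>
      have h1 := ih (by omega)
      have h2 : a (m + 1) ≤ (1 + c)⁻¹ * (a m + g m) + s := by
        rw [← sub_le_iff_le_add, inv_mul_eq_div, le_div_iff₀' hc']
        exact h m (by omega)
      have h3 : ∑ k ∈ Finset.range m, (1 + c)⁻¹ ^ (m + 1 - k) * g k =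
          (1 + c)⁻¹ * ∑ k ∈ Finset.range m, (1 + c)⁻¹ ^ (m - k) * g k := by
        rw [Finset.mul_sum]
        refine Finset.sum_congr rfl fun k hk => ?_
        rw [Nat.succ_sub (Finset.mem_range.1 hk).le, pow_succ']
        ring
      -- The constant is the fixed point of v ↦ v / (1 + c) + s, so it reproduces itself.
      have h4 : (1 + c)⁻¹ * (s * (1 + c) / c) + s = s * (1 + c) / c := by
        field_simp
      have h5 := mul_le_mul_of_nonneg_left h1 (inv_pos.2 hc').le
      rw [Finset.sum_range_succ, h3, pow_succ']
      simp only [Nat.add_sub_cancel_left, pow_one]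
      linarith
  have h1 : (1 + c)⁻¹ ^ T * a 0 ≤ a 0 :=
    mul_le_of_le_one_left ha (pow_le_one₀ (by positivity) (inv_le_one_of_one_le₀ (by linarith)))
  linarith [key T le_rfl]

/-- In the Grönwall bound for `a (T + 1)`, the weight of `g k` is at most 1/2 once `k < T - T₀` and
at most 1 otherwise. Subtracting leaves half of the early terms, and `a 0` cancels. -/
theorem half_sum_le_of_contraction_recursion {a g : ℕ → ℝ} {c s : ℝ} (hc : 0 < c) {T T₀ : ℕ}
    (hT₀ : 2 ≤ (1 + c) ^ T₀) (ha : 0 ≤ a 0) (hs : 0 ≤ s) (hg : ∀ k ≤ T, 0 ≤ g k)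
    (h : ∀ k ≤ T, (1 + c) * (a (k + 1) - s) ≤ a k + g k) :
    1 / 2 * ∑ k ∈ Finset.range (T - T₀), g k - s * (1 + c) / c ≤
      a 0 - a (T + 1) + ∑ k ∈ Finset.range (T + 1), g k := by
  have h1 := le_of_contraction_recursion hc (T := T + 1) ha hs fun k hk => h k (by omega)
  have h2 : ∑ k ∈ Finset.range (T + 1), (1 + c)⁻¹ ^ (T + 1 - k) * g k ≤
      ∑ k ∈ Finset.range (T + 1), (g k - if k < T - T₀ then 1 / 2 * g k else 0) := by
    refine Finset.sum_le_sum fun k hk => ?_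
    have hgk := hg k (by simpa [Nat.lt_succ_iff] using hk)
    have hr0 : 0 ≤ (1 + c)⁻¹ := by positivity
    have hr1 : (1 + c)⁻¹ ≤ 1 := inv_le_one_of_one_le₀ (by linarith)
    split_ifs with hkT
    · have h3 : (1 + c)⁻¹ ^ (T + 1 - k) ≤ (1 + c)⁻¹ ^ T₀ :=
        pow_le_pow_of_le_one hr0 hr1 (by omega)
      have h4 : (1 + c)⁻¹ ^ T₀ ≤ 1 / 2 := by
        rw [inv_pow, inv_le_comm₀ (by positivity) (by positivity)]
        simpa using hT₀
      nlinarith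
    · simpa using mul_le_of_le_one_left hgk (pow_le_one₀ hr0 hr1)
  rw [Finset.sum_sub_distrib, ← Finset.sum_filter, ← Finset.mul_sum] at h2
  have h3 : (Finset.range (T + 1)).filter (· < T - T₀) = Finset.range (T - T₀) := by
    ext k; simp; omega
  rw [h3] at h2
  linarith

/-! ### Second moments and white noise -/

/-- The random vector `y` is square integrable and uncorrelated with `w t, w (t + 1), …`. -/
structure IsUncorrelated {m n : ℕ} {Ω : Type*} [MeasurableSpace Ω] (μ : Measure Ω)
    (w : ℕ → Ω → EuclideanSpace ℝ (Fin n)) (t : ℕ) (y : Ω → Fin m → ℝ) : Prop where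
  memLp : ∀ i, MemLp (fun ω => y ω i) 2 μ
  uncorr : ∀ k, t ≤ k → ∀ i j, ∫ ω, y ω i * w k ω j ∂μ = 0

theorem memLp_two_mulVec {m l : ℕ} {Ω : Type*} [MeasurableSpace Ω] {μ : Measure Ω}
    {y : Ω → Fin m → ℝ} (hy : ∀ i, MemLp (fun ω => y ω i) 2 μ) (N : Matrix (Fin l) (Fin m) ℝ)
    (i : Fin l) : MemLp (fun ω => (N *ᵥ y ω) i) 2 μ := by
  simp only [mulVec, dotProduct]
  exact memLp_finsetSum _ fun j _ => (hy j).const_mul _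

theorem integrable_quad {m : ℕ} {Ω : Type*} [MeasurableSpace Ω] {μ : Measure Ω}
    {y z : Ω → Fin m → ℝ} (hy : ∀ i, MemLp (fun ω => y ω i) 2 μ)
    (hz : ∀ i, MemLp (fun ω => z ω i) 2 μ) (N : Matrix (Fin m) (Fin m) ℝ) :
    Integrable (fun ω => y ω ⬝ᵥ N *ᵥ z ω) μ := by
  simp only [dotProduct]
  exact integrable_finsetSum _ fun i _ => (hy i).integrable_mul (memLp_two_mulVec hz N i)

namespace IsUncorrelated

variable {m n : ℕ} {Ω : Type*} [MeasurableSpace Ω] {μ : Measure Ω}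
  {w : ℕ → Ω → EuclideanSpace ℝ (Fin n)} {t : ℕ} {y z : Ω → Fin m → ℝ}

theorem mono (hy : IsUncorrelated μ w t y) {s : ℕ} (h : t ≤ s) : IsUncorrelated μ w s y :=
  ⟨hy.memLp, fun k hk => hy.uncorr k (h.trans hk)⟩

/-- The reason for working with correlations: summands that are each independent of the future noise
need not have an independent sum, but vanishing correlation is additive. -/
theorem add (hw : ∀ k j, MemLp (fun ω => w k ω j) 2 μ) (hy : IsUncorrelated μ w t y)
    (hz : IsUncorrelated μ w t z) : IsUncorrelated μ w t (fun ω => y ω + z ω) := by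
  refine ⟨fun i => (hy.memLp i).add (hz.memLp i), fun k hk i j => ?_⟩
  have h1 : Integrable (fun ω => y ω i * w k ω j) μ := (hy.memLp i).integrable_mul (hw k j)
  have h2 : Integrable (fun ω => z ω i * w k ω j) μ := (hz.memLp i).integrable_mul (hw k j)
  simp only [Pi.add_apply, add_mul]
  rw [integral_add h1 h2, hy.uncorr k hk, hz.uncorr k hk, add_zero]

theorem mulVec (hw : ∀ k j, MemLp (fun ω => w k ω j) 2 μ) (hy : IsUncorrelated μ w t y)
    {l : ℕ} (N : Matrix (Fin l) (Fin m) ℝ) : IsUncorrelated μ w t (fun ω => N *ᵥ y ω) := by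
  refine ⟨memLp_two_mulVec hy.memLp N, fun k hk i j => ?_⟩
  have h (i' : Fin m) : Integrable (fun ω => N i i' * (y ω i' * w k ω j)) μ :=
    Integrable.const_mul ((hy.memLp i').integrable_mul (hw k j)) _
  simp only [Matrix.mulVec, dotProduct, Finset.sum_mul, mul_assoc]
  rw [integral_finsetSum _ fun i' _ => h i']
  simp only [integral_const_mul, hy.uncorr k hk, mul_zero, Finset.sum_const_zero]

end IsUncorrelated

/-- Second moments of a Gaussian noise process. -/
structure IsWhiteNoise {n : ℕ} {Ω : Type*} [MeasurableSpace Ω] (μ : Measure Ω)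
    (w : ℕ → Ω → EuclideanSpace ℝ (Fin n)) (σ2 : ℝ) : Prop where
  memLp : ∀ k j, MemLp (fun ω => w k ω j) 2 μ
  mean : ∀ k j, ∫ ω, w k ω j ∂μ = 0
  cov_self : ∀ k i j, ∫ ω, w k ω i * w k ω j ∂μ = if i = j then σ2 else 0
  uncorr : ∀ k l, k ≠ l → ∀ i j, ∫ ω, w k ω i * w l ω j ∂μ = 0

namespace IsWhiteNoise

variable {m n : ℕ} {Ω : Type*} [MeasurableSpace Ω] {μ : Measure Ω}
  {w : ℕ → Ω → EuclideanSpace ℝ (Fin n)} {σ2 : ℝ}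

theorem isUncorrelated (hw : IsWhiteNoise μ w σ2) (t : ℕ) :
    IsUncorrelated μ w (t + 1) (fun ω => (w t ω).ofLp) :=
  ⟨hw.memLp t, fun _ hk i j => hw.uncorr _ _ (by omega) i j⟩

/-- The cross term is a correlation with the noise at time `t`, hence 0; the pure noise term sees
only the diagonal of `P`. -/
theorem integral_quad_add (hw : IsWhiteNoise μ w σ2) {t : ℕ} {y : Ω → Fin n → ℝ}
    (hy : IsUncorrelated μ w t y) {P : Matrix (Fin n) (Fin n) ℝ} (hP : P.PosSemidef) :
    ∫ ω, (y ω + (w t ω).ofLp) ⬝ᵥ P *ᵥ (y ω + (w t ω).ofLp) ∂μ =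
      ∫ ω, y ω ⬝ᵥ P *ᵥ y ω ∂μ + σ2 * P.trace := by
  have h (ω : Ω) : (y ω + (w t ω).ofLp) ⬝ᵥ P *ᵥ (y ω + (w t ω).ofLp) =
      y ω ⬝ᵥ P *ᵥ y ω + 2 * ((P *ᵥ y ω) ⬝ᵥ (w t ω).ofLp) +
        (w t ω).ofLp ⬝ᵥ P *ᵥ (w t ω).ofLp := by
    simp only [mulVec_add, dotProduct_add, add_dotProduct]
    rw [hP.dotProduct_mulVec_comm (y ω) (w t ω).ofLp, dotProduct_comm (P *ᵥ y ω)]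
    ring
  have hPy := hy.mulVec hw.memLp P
  have hi (j : Fin n) : Integrable (fun ω => (P *ᵥ y ω) j * (w t ω).ofLp j) μ :=
    (hPy.memLp j).integrable_mul (hw.memLp t j)
  have hcross : ∫ ω, (P *ᵥ y ω) ⬝ᵥ (w t ω).ofLp ∂μ = 0 := by
    simp only [dotProduct]
    rw [integral_finsetSum _ fun j _ => hi j]
    exact Finset.sum_eq_zero fun j _ => hPy.uncorr t le_rfl j j
  have hnoise : ∫ ω, (w t ω).ofLp ⬝ᵥ P *ᵥ (w t ω).ofLp ∂μ = σ2 * P.trace := by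
    simp only [dotProduct, mulVec, Finset.mul_sum]
    have hij (i j : Fin n) : Integrable
        (fun ω => (w t ω).ofLp i * (P i j * (w t ω).ofLp j)) μ :=
      (hw.memLp t i).integrable_mul ((hw.memLp t j).const_mul _)
    rw [integral_finsetSum _ fun i _ => integrable_finsetSum _ fun j _ => hij i j]
    have h1 (i : Fin n) : ∫ ω, ∑ j, (w t ω).ofLp i * (P i j * (w t ω).ofLp j) ∂μ =
        P i i * σ2 := by
      rw [integral_finsetSum _ fun j _ => hij i j]
      simp only [mul_left_comm _ (P i _), integral_const_mul, hw.cov_self]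
      simp
    simp only [h1, trace, Finset.mul_sum, diag_apply, mul_comm]
  have hc : Integrable (fun ω => (P *ᵥ y ω) ⬝ᵥ (w t ω).ofLp) μ := by
    simp only [dotProduct]
    exact integrable_finsetSum _ fun j _ => hi j
  have hyy := integrable_quad hy.memLp hy.memLp P
  simp only [h]
  have hyc : Integrable (fun ω => y ω ⬝ᵥ P *ᵥ y ω + 2 * ((P *ᵥ y ω) ⬝ᵥ (w t ω).ofLp)) μ :=
    hyy.add (hc.const_mul 2)
  rw [integral_add hyc (integrable_quad (hw.memLp t) (hw.memLp t) P),
    integral_add hyy (hc.const_mul 2), integral_const_mul, hcross, hnoise]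
  ring

end IsWhiteNoise

theorem isWhiteNoise_of_gaussian {n : ℕ} {Ω : Type*} [MeasurableSpace Ω] {μ : Measure Ω}
    {w : ℕ → Ω → EuclideanSpace ℝ (Fin n)} {σ2 : ℝ} (hσ : 0 ≤ σ2)
    (hm : ∀ t, Measurable (w t))
    (hlaw : ∀ t, μ.map (w t) = multivariateGaussian 0 (σ2 • (1 : Matrix (Fin n) (Fin n) ℝ)))
    (hind : iIndepFun w μ) : IsWhiteNoise μ w σ2 := by
  have hpsd : (σ2 • (1 : Matrix (Fin n) (Fin n) ℝ)).PosSemidef := PosSemidef.one.smul hσ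
  set γ := multivariateGaussian 0 (σ2 • (1 : Matrix (Fin n) (Fin n) ℝ)) with hγ
  have hL2 (j : Fin n) : MemLp (fun x : EuclideanSpace ℝ (Fin n) => x j) 2 γ :=
    (IsGaussian.memLp_two_id (μ := γ)).continuousLinearMap_comp
      (EuclideanSpace.proj j : EuclideanSpace ℝ (Fin n) →L[ℝ] ℝ)
  have hmean (j : Fin n) : ∫ x, x j ∂γ = 0 := by
    have h := (EuclideanSpace.proj (𝕜 := ℝ) j).integral_comp_id_comm
      (IsGaussian.integrable_id (μ := γ))
    rw [hγ, integral_id_multivariateGaussian] at h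
    simpa using h
  have hmean' (k : ℕ) (j : Fin n) : ∫ ω, w k ω j ∂μ = 0 := by
    rw [← hmean j, ← hlaw k, integral_map (hm k).aemeasurable (by fun_prop)]
  refine ⟨fun k j => ?_, hmean', fun k i j => ?_, fun k l hkl i j => ?_⟩
  · have h := hL2 j
    rw [← hlaw k] at h
    exact h.comp_of_map (hm k).aemeasurable
  · have h := covariance_eval_multivariateGaussian (μ := 0) hpsd i j
    rw [← hγ, covariance_eq_sub (hL2 i) (hL2 j), hmean, hmean] at h
    rw [← hlaw k] at h
    simp only [mul_zero, sub_zero, Pi.mul_apply] at h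
    rw [integral_map (hm k).aemeasurable (by fun_prop)] at h
    rw [h]
    simp [one_apply]
  · have h : IndepFun (fun ω => w k ω i) (fun ω => w l ω j) μ :=
      (hind.indepFun hkl).comp (φ := fun x : EuclideanSpace ℝ (Fin n) => x i)
        (ψ := fun x : EuclideanSpace ℝ (Fin n) => x j) (by fun_prop) (by fun_prop)
    rw [h.integral_fun_mul_eq_mul_integral]
    · rw [hmean', zero_mul]
    · exact (by fun_prop : Measurable fun ω => w k ω i).aestronglyMeasurable
    · exact (by fun_prop : Measurable fun ω => w l ω j).aestronglyMeasurable

theorem isUncorrelated_of_indepFun {m n : ℕ} {Ω : Type*} [MeasurableSpace Ω] {μ : Measure Ω}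
    {w : ℕ → Ω → EuclideanSpace ℝ (Fin n)} {σ2 : ℝ} (hw : IsWhiteNoise μ w σ2) {t : ℕ}
    {y : Ω → EuclideanSpace ℝ (Fin m)} (hL2 : ∀ i, MemLp (fun ω => y ω i) 2 μ)
    (hind : IndepFun y (fun ω (k : ℕ) => w (t + k) ω) μ) :
    IsUncorrelated μ w t (fun ω => (y ω).ofLp) := by
  refine ⟨hL2, fun k hk i j => ?_⟩
  obtain ⟨d, rfl⟩ := Nat.exists_eq_add_of_le hk
  have h : IndepFun (fun ω => y ω i) (fun ω => w (t + d) ω j) μ :=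
    hind.comp (φ := fun x : EuclideanSpace ℝ (Fin m) => x i)
      (ψ := fun f : ℕ → EuclideanSpace ℝ (Fin n) => f d j) (by fun_prop) (by fun_prop)
  rw [h.integral_fun_mul_eq_mul_integral (hL2 i).1 (hw.memLp _ j).1, hw.mean, mul_zero]

/-! ### Expected costs and the Bellman identity along trajectories -/

namespace LQR

variable {n p : ℕ} {Ω : Type*} [MeasurableSpace Ω] {μ : Measure Ω}

theorem cost_nonneg {S : LQR n p} (hQ : S.Q.PosDef) (hR : S.R.PosDef)
    (x : EuclideanSpace ℝ (Fin n)) (u : EuclideanSpace ℝ (Fin p)) : 0 ≤ S.cost x u :=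
  add_nonneg (hQ.posSemidef.quad_nonneg _) (hR.posSemidef.quad_nonneg _)

theorem measurable_cost (S : LQR n p) {x : Ω → EuclideanSpace ℝ (Fin n)}
    {u : Ω → EuclideanSpace ℝ (Fin p)} (hx : Measurable x) (hu : Measurable u) :
    Measurable fun ω => S.cost (x ω) (u ω) := by
  simp only [cost, dotProduct, Matrix.mulVec]
  fun_prop

theorem integrable_cost (S : LQR n p) {x : Ω → EuclideanSpace ℝ (Fin n)}
    {u : Ω → EuclideanSpace ℝ (Fin p)} (hx : ∀ i, MemLp (fun ω => x ω i) 2 μ)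
    (hu : ∀ i, MemLp (fun ω => u ω i) 2 μ) : Integrable (fun ω => S.cost (x ω) (u ω)) μ :=
  (integrable_quad hx hx S.Q).add (integrable_quad hu hu S.R)

theorem expectedCost_eq {S : LQR n p} (hQ : S.Q.PosDef) (hR : S.R.PosDef)
    {x : Ω → EuclideanSpace ℝ (Fin n)} {u : Ω → EuclideanSpace ℝ (Fin p)}
    (hx : ∀ i, MemLp (fun ω => x ω i) 2 μ) (hu : ∀ i, MemLp (fun ω => u ω i) 2 μ) :
    S.expectedCost μ x u = ENNReal.ofReal (∫ ω, S.cost (x ω) (u ω) ∂μ) :=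
  (ofReal_integral_eq_lintegral_ofReal (S.integrable_cost hx hu)
    (ae_of_all _ fun _ => cost_nonneg hQ hR _ _)).symm

theorem memLp_two_of_integrable_quad {m : ℕ} {M : Matrix (Fin m) (Fin m) ℝ} (hM : M.PosDef)
    {y : Ω → EuclideanSpace ℝ (Fin m)} (hy : Measurable y) {F : Ω → ℝ} (hF : Integrable F μ)
    (hle : ∀ ω, (y ω).ofLp ⬝ᵥ M *ᵥ (y ω).ofLp ≤ F ω) (i : Fin m) :
    MemLp (fun ω => y ω i) 2 μ := by
  have hmeas : Measurable fun ω => y ω i := by fun_prop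
  rw [memLp_two_iff_integrable_sq hmeas.aestronglyMeasurable]
  obtain ⟨c, hc, h⟩ := exists_pos_mul_quad_le (1 : Matrix (Fin m) (Fin m) ℝ) hM
  refine (hF.const_mul c⁻¹).mono' (hmeas.pow_const 2).aestronglyMeasurable
    (ae_of_all _ fun ω => ?_)
  rw [Real.norm_of_nonneg (sq_nonneg _), inv_mul_eq_div, le_div_iff₀' hc]
  refine le_trans ?_ ((h (y ω).ofLp).trans (hle ω))
  rw [one_mulVec]
  refine mul_le_mul_of_nonneg_left ?_ hc.le
  rw [sq]
  exact Finset.single_le_sum (f := fun j => (y ω).ofLp j * (y ω).ofLp j)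
    (fun j _ => mul_self_nonneg _) (Finset.mem_univ i)

/-- Positive definiteness lets the cost control every squared coordinate. So the second moment
calculus applies whenever the regret is not trivially infinite. -/
theorem memLp_two_of_expectedCost_ne_top {S : LQR n p} (hQ : S.Q.PosDef) (hR : S.R.PosDef)
    {x : Ω → EuclideanSpace ℝ (Fin n)} {u : Ω → EuclideanSpace ℝ (Fin p)}
    (hx : Measurable x) (hu : Measurable u) (h : S.expectedCost μ x u ≠ ∞) :
    (∀ i, MemLp (fun ω => x ω i) 2 μ) ∧ ∀ i, MemLp (fun ω => u ω i) 2 μ := by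
  have hint : Integrable (fun ω => S.cost (x ω) (u ω)) μ := by
    refine ⟨(S.measurable_cost hx hu).aestronglyMeasurable, ?_⟩
    rw [hasFiniteIntegral_iff_ofReal (ae_of_all _ fun _ => cost_nonneg hQ hR _ _)]
    exact h.lt_top
  exact ⟨memLp_two_of_integrable_quad hQ hx hint fun ω =>
      le_add_of_nonneg_right (hR.posSemidef.quad_nonneg _),
    memLp_two_of_integrable_quad hR hu hint fun ω =>
      le_add_of_nonneg_left (hQ.posSemidef.quad_nonneg _)⟩

end LQR

namespace LQR

variable {n p : ℕ} {Ω : Type*} [MeasurableSpace Ω] {μ : Measure Ω} {S : LQR n p}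
  {ν : Measure (EuclideanSpace ℝ (Fin n))}
  {x : ℕ → Ω → EuclideanSpace ℝ (Fin n)} {u : ℕ → Ω → EuclideanSpace ℝ (Fin p)}
  {w : ℕ → Ω → EuclideanSpace ℝ (Fin n)}

theorem riccati_Pstar (hQ : S.Q.PosDef) (hR : S.R.PosDef) (hAB : IsControllable S.A S.B) :
    S.riccati S.Pstar = S.Pstar :=
  (isRiccatiSolution_Pstar hQ hR hAB).2.symm

theorem gain_Pstar (S : LQR n p) : S.gain S.Pstar = S.Kstar := rfl

theorem Pstar_posSemidef (hQ : S.Q.PosDef) (hR : S.R.PosDef) (hAB : IsControllable S.A S.B) :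
    S.Pstar.PosSemidef :=
  (isRiccatiSolution_Pstar hQ hR hAB).1

/-- The deviation of the input from the optimal feedback, in the norm that measures its cost. -/
noncomputable def deviation (S : LQR n p) (x : EuclideanSpace ℝ (Fin n))
    (u : EuclideanSpace ℝ (Fin p)) : ℝ :=
  (u.ofLp - S.Kstar *ᵥ x.ofLp) ⬝ᵥ S.inputWeight S.Pstar *ᵥ (u.ofLp - S.Kstar *ᵥ x.ofLp)

/-- The expected optimal cost-to-go. -/
noncomputable def meanValue (S : LQR n p) (μ : Measure Ω) (x : Ω → EuclideanSpace ℝ (Fin n)) : ℝ :=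
  ∫ ω, (x ω).ofLp ⬝ᵥ S.Pstar *ᵥ (x ω).ofLp ∂μ

theorem meanValue_nonneg (hQ : S.Q.PosDef) (hR : S.R.PosDef) (hAB : IsControllable S.A S.B)
    (y : Ω → EuclideanSpace ℝ (Fin n)) : 0 ≤ S.meanValue μ y :=
  integral_nonneg fun _ => (Pstar_posSemidef hQ hR hAB).quad_nonneg _

theorem noiseVar_mul_trace_nonneg (hQ : S.Q.PosDef) (hR : S.R.PosDef) (hσ : 0 ≤ S.noiseVar)
    (hAB : IsControllable S.A S.B) : 0 ≤ S.noiseVar * S.Pstar.trace :=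
  mul_nonneg hσ (Pstar_posSemidef hQ hR hAB).trace_nonneg

namespace IsTrajectory

theorem measurable_state (h : S.IsTrajectory μ ν x u w) (t : ℕ) : Measurable (x t) := by
  induction t with
  | zero => exact h.measurable_init
  | succ t ih =>
    have hu := h.measurable_input t
    have hw := h.measurable_noise t
    have : x (t + 1) = fun ω => WithLp.toLp 2 (S.A *ᵥ (x t ω).ofLp + S.B *ᵥ (u t ω).ofLp +
        (w t ω).ofLp) := by
      funext ω
      rw [← h.dynamics]
    rw [this]
    refine (WithLp.measurable_toLp 2 _).comp (measurable_pi_iff.2 fun i => ?_)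
    simp only [Pi.add_apply, mulVec, dotProduct]
    fun_prop

theorem isWhiteNoise (h : S.IsTrajectory μ ν x u w) (hσ : 0 ≤ S.noiseVar) :
    IsWhiteNoise μ w S.noiseVar :=
  isWhiteNoise_of_gaussian hσ h.measurable_noise h.law_noise h.indep_noise

theorem isUncorrelated_input (h : S.IsTrajectory μ ν x u w) (hσ : 0 ≤ S.noiseVar) {t : ℕ}
    (hu : ∀ i, MemLp (fun ω => u t ω i) 2 μ) :
    IsUncorrelated μ w t fun ω => (u t ω).ofLp :=
  isUncorrelated_of_indepFun (h.isWhiteNoise hσ) hu (h.indep_input t)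

theorem isUncorrelated_drift (h : S.IsTrajectory μ ν x u w) (hσ : 0 ≤ S.noiseVar) {t : ℕ}
    (hx : IsUncorrelated μ w t fun ω => (x t ω).ofLp)
    (hu : ∀ i, MemLp (fun ω => u t ω i) 2 μ) :
    IsUncorrelated μ w t fun ω => S.A *ᵥ (x t ω).ofLp + S.B *ᵥ (u t ω).ofLp := by
  have hw := h.isWhiteNoise hσ
  exact (hx.mulVec hw.memLp S.A).add hw.memLp
    ((h.isUncorrelated_input hσ hu).mulVec hw.memLp S.B)

theorem isUncorrelated_state (h : S.IsTrajectory μ ν x u w) (hσ : 0 ≤ S.noiseVar)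
    (hx0 : ∀ i, MemLp (fun ω => x 0 ω i) 2 μ) {t : ℕ}
    (hu : ∀ k < t, ∀ i, MemLp (fun ω => u k ω i) 2 μ) :
    IsUncorrelated μ w t fun ω => (x t ω).ofLp := by
  have hw := h.isWhiteNoise hσ
  induction t with
  | zero =>
    refine isUncorrelated_of_indepFun hw hx0 ?_
    simpa using h.indep_init
  | succ t ih =>
    simp only [h.dynamics]
    exact ((h.isUncorrelated_drift hσ (ih fun k hk => hu k (by omega))
      (hu t (by omega))).mono t.le_succ).add hw.memLp (hw.isUncorrelated t)

theorem meanValue_succ (h : S.IsTrajectory μ ν x u w) (hQ : S.Q.PosDef) (hR : S.R.PosDef)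
    (hσ : 0 ≤ S.noiseVar) (hAB : IsControllable S.A S.B) {t : ℕ}
    (hx : IsUncorrelated μ w t fun ω => (x t ω).ofLp)
    (hu : ∀ i, MemLp (fun ω => u t ω i) 2 μ) : S.meanValue μ (x (t + 1)) =
    ∫ ω, (S.A *ᵥ (x t ω).ofLp + S.B *ᵥ (u t ω).ofLp) ⬝ᵥ S.Pstar *ᵥ
      (S.A *ᵥ (x t ω).ofLp + S.B *ᵥ (u t ω).ofLp) ∂μ + S.noiseVar * S.Pstar.trace := by
  rw [← (h.isWhiteNoise hσ).integral_quad_add (h.isUncorrelated_drift hσ hx hu)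
    (Pstar_posSemidef hQ hR hAB)]
  simp only [meanValue, h.dynamics]

end IsTrajectory

theorem memLp_two_sub_Kstar {x : Ω → EuclideanSpace ℝ (Fin n)}
    {u : Ω → EuclideanSpace ℝ (Fin p)} (hx : ∀ i, MemLp (fun ω => x ω i) 2 μ)
    (hu : ∀ i, MemLp (fun ω => u ω i) 2 μ) (i : Fin p) :
    MemLp (fun ω => ((u ω).ofLp - S.Kstar *ᵥ (x ω).ofLp) i) 2 μ :=
  (hu i).sub (memLp_two_mulVec (y := fun ω => (x ω).ofLp) hx S.Kstar i)

theorem integrable_deviation {x : Ω → EuclideanSpace ℝ (Fin n)}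
    {u : Ω → EuclideanSpace ℝ (Fin p)} (hx : ∀ i, MemLp (fun ω => x ω i) 2 μ)
    (hu : ∀ i, MemLp (fun ω => u ω i) 2 μ) :
    Integrable (fun ω => S.deviation (x ω) (u ω)) μ :=
  integrable_quad (memLp_two_sub_Kstar hx hu) (memLp_two_sub_Kstar hx hu) _

theorem deviation_nonneg (hQ : S.Q.PosDef) (hR : S.R.PosDef) (hAB : IsControllable S.A S.B)
    (x : EuclideanSpace ℝ (Fin n)) (u : EuclideanSpace ℝ (Fin p)) : 0 ≤ S.deviation x u :=
  (inputWeight_posDef hR (Pstar_posSemidef hQ hR hAB)).posSemidef.quad_nonneg _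

namespace IsTrajectory

/-- Expectation of `bellman_identity` at the fixed point `Pstar`; the noise adds `noiseVar * trace`
to the next value. -/
theorem integral_cost_add_meanValue_succ (h : S.IsTrajectory μ ν x u w) (hQ : S.Q.PosDef)
    (hR : S.R.PosDef) (hσ : 0 ≤ S.noiseVar) (hAB : IsControllable S.A S.B) {t : ℕ}
    (hx : IsUncorrelated μ w t fun ω => (x t ω).ofLp)
    (hu : ∀ i, MemLp (fun ω => u t ω i) 2 μ) :
    ∫ ω, S.cost (x t ω) (u t ω) ∂μ + S.meanValue μ (x (t + 1)) =
      S.meanValue μ (x t) + ∫ ω, S.deviation (x t ω) (u t ω) ∂μ +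
        S.noiseVar * S.Pstar.trace := by
  have hd := h.isUncorrelated_drift hσ hx hu
  rw [h.meanValue_succ hQ hR hσ hAB hx hu, ← add_assoc, meanValue,
    ← integral_add (S.integrable_cost hx.memLp hu) (integrable_quad hd.memLp hd.memLp _),
    ← integral_add (integrable_quad hx.memLp hx.memLp _) (integrable_deviation hx.memLp hu)]
  congr 2 with ω
  have hb := bellman_identity hR (Pstar_posSemidef hQ hR hAB) (x t ω).ofLp (u t ω).ofLp
  rw [riccati_Pstar hQ hR hAB, gain_Pstar] at hb
  exact hb

/-- In the averaged Bellman identity, the cost is replaced by its lower bound, `c` times the next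
value without its noise part. -/
theorem meanValue_contraction (h : S.IsTrajectory μ ν x u w) (hQ : S.Q.PosDef)
    (hR : S.R.PosDef) (hσ : 0 ≤ S.noiseVar) (hAB : IsControllable S.A S.B) {t : ℕ}
    (hx : IsUncorrelated μ w t fun ω => (x t ω).ofLp)
    (hu : ∀ i, MemLp (fun ω => u t ω i) 2 μ) {c : ℝ}
    (hc : ∀ (x : Fin n → ℝ) (u : Fin p → ℝ),
      c * ((S.A *ᵥ x + S.B *ᵥ u) ⬝ᵥ S.Pstar *ᵥ (S.A *ᵥ x + S.B *ᵥ u)) ≤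
        x ⬝ᵥ S.Q *ᵥ x + u ⬝ᵥ S.R *ᵥ u) :
    (1 + c) * (S.meanValue μ (x (t + 1)) - S.noiseVar * S.Pstar.trace) ≤
      S.meanValue μ (x t) + ∫ ω, S.deviation (x t ω) (u t ω) ∂μ := by
  have hd := h.isUncorrelated_drift hσ hx hu
  have h1 := h.integral_cost_add_meanValue_succ hQ hR hσ hAB hx hu
  have h2 := h.meanValue_succ hQ hR hσ hAB hx hu
  have h3 := integral_mono ((integrable_quad hd.memLp hd.memLp S.Pstar).const_mul c)
    (S.integrable_cost hx.memLp hu) fun ω => hc (x t ω).ofLp (u t ω).ofLp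
  rw [integral_const_mul] at h3
  rw [h2] at h1 ⊢
  rw [add_sub_cancel_right, add_mul, one_mul]
  refine (add_le_add_right h3 _).trans ?_
  linarith

end IsTrajectory

/-- Dominating deviations by the excitation of the data. -/
theorem excitation_le_sum_integral_deviation [IsProbabilityMeasure μ] (hn : 0 < n) (hp : 0 < p)
    (hQ : S.Q.PosDef) (hR : S.R.PosDef) (hAB : IsControllable S.A S.B) {N : ℕ}
    (hx : ∀ k < N, ∀ i, MemLp (fun ω => x k ω i) 2 μ)
    (hu : ∀ k < N, ∀ i, MemLp (fun ω => u k ω i) 2 μ) {δ b : ℝ} (hδ : δ ≤ 1)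
    (hf : 1 - δ ≤ μ.real {ω | b ≤ lambdaMin (empiricalCov x u N ω)}) :
    (1 - δ) * lambdaMin S.R * (1 + sigmaMin S.Kstar ^ 2) * b ≤
      ∑ k ∈ Finset.range N, ∫ ω, S.deviation (x k ω) (u k ω) ∂μ := by
  have hlam := lambdaMin_nonneg hR.posSemidef
  set r := lambdaMin S.R * (1 + sigmaMin S.Kstar ^ 2) with hr
  have hr0 : 0 ≤ r := by positivity
  -- For `b ≤ 0` the left side is nonpositive; for `b ≥ 0` Markov's inequality is applied at level
  -- `r * b`.
  rcases le_total b 0 with hb | hb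
  · refine le_trans ?_ (Finset.sum_nonneg fun k _ =>
      integral_nonneg fun ω => deviation_nonneg hQ hR hAB _ _)
    rw [mul_assoc (1 - δ), ← hr]
    exact mul_nonpos_of_nonneg_of_nonpos (mul_nonneg (by linarith) hr0) hb
  have hint (k : ℕ) (hk : k ∈ Finset.range N) :
      Integrable (fun ω => S.deviation (x k ω) (u k ω)) μ :=
    integrable_deviation (hx k (Finset.mem_range.1 hk)) (hu k (Finset.mem_range.1 hk))
  rw [← integral_finsetSum _ hint]
  have hmarkov := mul_meas_ge_le_integral_of_nonneg
    (ae_of_all μ fun ω => Finset.sum_nonneg fun k _ => deviation_nonneg hQ hR hAB (x k ω) (u k ω))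
    (integrable_finsetSum (Finset.range N) hint) (r * b)
  have hsub : {ω | b ≤ lambdaMin (empiricalCov x u N ω)} ⊆
      {ω | r * b ≤ ∑ k ∈ Finset.range N, S.deviation (x k ω) (u k ω)} := by
    intro ω hω
    have h1 := lambdaMin_empiricalCov_mul_le x u N ω S.Kstar
    have h2 := sigmaMin_sq_le hn S.Kstar
    have hp1 : (1 : ℝ) ≤ p := by exact_mod_cast hp
    have h3 : (1 + sigmaMin S.Kstar ^ 2) * b ≤
        lambdaMin (empiricalCov x u N ω) * (p + ∑ i, ∑ j, S.Kstar i j ^ 2) := by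
      rw [mul_comm]
      exact mul_le_mul hω (add_le_add hp1 h2) (by positivity) (hb.trans hω)
    rw [Set.mem_ofPred_eq, hr, mul_assoc]
    refine (mul_le_mul_of_nonneg_left (h3.trans h1) hlam).trans ?_
    rw [Finset.mul_sum]
    exact Finset.sum_le_sum fun k _ => (lambdaMin_mul_le_quad hR.posSemidef _).trans
      (quad_le_quad_inputWeight S (Pstar_posSemidef hQ hR hAB) _)
  have hmono := hf.trans (measureReal_mono hsub)
  calc _ = r * b * (1 - δ) := by rw [hr]; ring
    _ ≤ _ := mul_le_mul_of_nonneg_left hmono (mul_nonneg hr0 hb)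
    _ ≤ _ := hmarkov

end LQR

/-! ### The optimal closed loop and the upper bound on J⋆ -/

theorem indepFun_future {Ω E F : Type*} {mΩ : MeasurableSpace Ω} [MeasurableSpace E]
    [MeasurableSpace F] {μ : Measure Ω} {w : ℕ → Ω → E} (hw : ∀ t, Measurable (w t))
    (hind : iIndepFun w μ) {t : ℕ} {y : Ω → F}
    (hy : Measurable[⨆ i ∈ Set.Iio t, MeasurableSpace.comap (w i) inferInstance] y) :
    IndepFun y (fun ω (k : ℕ) => w (t + k) ω) μ := by
  have h := indep_iSup_of_disjoint (fun i => (hw i).comap_le) hind.iIndep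
    (S := Set.Iio t) (T := Set.Ici t) (Set.Iio_disjoint_Ici le_rfl)
  refine indep_of_indep_of_le_left (indep_of_indep_of_le_right h ?_) hy.comap_le
  refine Measurable.comap_le ?_
  refine @measurable_pi_lambda _ _ _ (_) _ _ fun k => ?_
  exact measurable_iff_comap_le.2
    (le_iSup₂_of_le (f := fun i (_ : i ∈ Set.Ici t) => MeasurableSpace.comap (w i) inferInstance)
      (t + k) (Set.mem_Ici.2 (Nat.le_add_right t k)) le_rfl)

namespace LQR

variable {n p : ℕ}

/-- The state of the optimal closed loop, started at `0`, as a function of the noise. -/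
noncomputable def optState (S : LQR n p) :
    ℕ → (ℕ → EuclideanSpace ℝ (Fin n)) → EuclideanSpace ℝ (Fin n)
  | 0, _ => 0
  | t + 1, ω => WithLp.toLp 2 (S.A *ᵥ (S.optState t ω).ofLp +
      S.B *ᵥ (S.Kstar *ᵥ (S.optState t ω).ofLp) + (ω t).ofLp)

/-- The optimal inputs, as a function of the noise. -/
noncomputable def optInput (S : LQR n p) (t : ℕ) (ω : ℕ → EuclideanSpace ℝ (Fin n)) :
    EuclideanSpace ℝ (Fin p) :=
  WithLp.toLp 2 (S.Kstar *ᵥ (S.optState t ω).ofLp)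

/-- The state at time `t` depends only on the noise strictly before `t`, which makes the feedback
inputs admissible by `indepFun_future`. -/
theorem measurable_optState (S : LQR n p) (t : ℕ) :
    Measurable[⨆ i ∈ Set.Iio t, MeasurableSpace.comap
      (fun ω : ℕ → EuclideanSpace ℝ (Fin n) => ω i) inferInstance] (S.optState t) := by
  induction t with
  | zero => exact measurable_const
  | succ t ih =>
    set m := ⨆ i ∈ Set.Iio (t + 1), MeasurableSpace.comap
      (fun ω : ℕ → EuclideanSpace ℝ (Fin n) => ω i) inferInstance
    have h1 : Measurable[m] (S.optState t) :=
      ih.mono (biSup_mono fun i (hi : i < t) => Nat.lt_succ_of_lt hi) le_rfl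
    have h2 : Measurable[m] fun ω : ℕ → EuclideanSpace ℝ (Fin n) => ω t :=
      measurable_iff_comap_le.2 (le_iSup₂_of_le (f := fun i (_ : i ∈ Set.Iio (t + 1)) =>
        MeasurableSpace.comap (fun ω : ℕ → EuclideanSpace ℝ (Fin n) => ω i) inferInstance)
        t (Set.mem_Iio.2 t.lt_succ_self) le_rfl)
    have h3 : Measurable fun q : EuclideanSpace ℝ (Fin n) × EuclideanSpace ℝ (Fin n) =>
        WithLp.toLp 2 (S.A *ᵥ q.1.ofLp + S.B *ᵥ (S.Kstar *ᵥ q.1.ofLp) + q.2.ofLp) := by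
      refine (WithLp.measurable_toLp 2 _).comp (measurable_pi_iff.2 fun i => ?_)
      simp only [Pi.add_apply, mulVec, dotProduct]
      fun_prop
    have h4 : S.optState (t + 1) = (fun q : EuclideanSpace ℝ (Fin n) × EuclideanSpace ℝ (Fin n) =>
        WithLp.toLp 2 (S.A *ᵥ q.1.ofLp + S.B *ᵥ (S.Kstar *ᵥ q.1.ofLp) + q.2.ofLp)) ∘
        fun ω => (S.optState t ω, ω t) := by
      funext ω
      rw [optState, Function.comp_apply]
    rw [h4]
    exact Measurable.comp h3 (h1.prodMk h2)

theorem measurable_toLp_mulVec {m l : ℕ} (K : Matrix (Fin l) (Fin m) ℝ) :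
    Measurable fun q : EuclideanSpace ℝ (Fin m) =>
      (WithLp.toLp 2 (K *ᵥ q.ofLp) : EuclideanSpace ℝ (Fin l)) := by
  refine (WithLp.measurable_toLp 2 _).comp (measurable_pi_iff.2 fun i => ?_)
  simp only [mulVec, dotProduct]
  fun_prop

/-- The law of the noise process. -/
noncomputable def noiseLaw (S : LQR n p) : Measure (ℕ → EuclideanSpace ℝ (Fin n)) :=
  Measure.infinitePi fun _ => multivariateGaussian 0 (S.noiseVar • (1 : Matrix (Fin n) (Fin n) ℝ))

instance (S : LQR n p) : IsProbabilityMeasure S.noiseLaw := by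
  unfold noiseLaw; infer_instance

theorem isTrajectory_opt (S : LQR n p) :
    S.IsTrajectory S.noiseLaw (Measure.dirac 0) S.optState S.optInput (fun t ω => ω t) := by
  have hle (t : ℕ) : ⨆ i ∈ Set.Iio t, MeasurableSpace.comap
      (fun ω : ℕ → EuclideanSpace ℝ (Fin n) => ω i) inferInstance ≤ MeasurableSpace.pi :=
    iSup₂_le fun i _ => (measurable_pi_apply i).comap_le
  have hind : iIndepFun (fun t (ω : ℕ → EuclideanSpace ℝ (Fin n)) => ω t) S.noiseLaw :=
    iIndepFun_infinitePi (X := fun _ (y : EuclideanSpace ℝ (Fin n)) => y) fun _ => measurable_id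
  refine
    { measurable_init := (S.measurable_optState 0).mono (hle 0) le_rfl
      measurable_input := fun t => (measurable_toLp_mulVec S.Kstar).comp
        ((S.measurable_optState t).mono (hle t) le_rfl)
      measurable_noise := fun t => measurable_pi_apply t
      law_init := ?_
      law_noise := fun t => Measure.infinitePi_map_eval _ t
      indep_noise := hind
      indep_init := ?_
      indep_input := fun t => indepFun_future (fun t => measurable_pi_apply t) hind
        ((measurable_toLp_mulVec S.Kstar).comp (S.measurable_optState t))
      dynamics := fun t ω => rfl }
  · have : S.optState 0 = fun _ => 0 := rfl
    rw [this, Measure.map_const, measure_univ, one_smul]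
  · have := indepFun_future (fun t => measurable_pi_apply t) hind (S.measurable_optState 0)
    simpa using this

/-- Along the optimal feedback the deviations vanish, so the costs telescope to a difference of
values plus `s` per step. The contraction keeps the values bounded, and their difference disappears
after division by `T`. -/
theorem Jstar_le {S : LQR n p} (hQ : S.Q.PosDef) (hR : S.R.PosDef) (hσ : 0 ≤ S.noiseVar)
    (hAB : IsControllable S.A S.B) : S.Jstar ≤ ENNReal.ofReal (S.noiseVar * S.Pstar.trace) := by
  have h := S.isTrajectory_opt
  set μ := S.noiseLaw
  set s := S.noiseVar * S.Pstar.trace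
  have hs : 0 ≤ s := noiseVar_mul_trace_nonneg hQ hR hσ hAB
  refine sInf_le ⟨_, _, μ, inferInstance, _, _, _, h, ?_⟩
  have hw := h.isWhiteNoise hσ
  have hxu (t : ℕ) : (∀ i, MemLp (fun ω => S.optState t ω i) 2 μ) ∧
      ∀ i, MemLp (fun ω => S.optInput t ω i) 2 μ := by
    have hu {t : ℕ} (hx : ∀ i, MemLp (fun ω => S.optState t ω i) 2 μ) (i : Fin p) :
        MemLp (fun ω => S.optInput t ω i) 2 μ :=
      memLp_two_mulVec (y := fun ω => (S.optState t ω).ofLp) hx S.Kstar i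
    refine ⟨?_, hu ?_⟩ <;>
    · induction t with
      | zero => exact fun i => MemLp.zero
      | succ t ih =>
        intro i
        exact ((memLp_two_mulVec (y := fun ω => (S.optState t ω).ofLp) ih S.A i).add
          (memLp_two_mulVec (y := fun ω => (S.optInput t ω).ofLp) (hu ih) S.B i)).add
          (hw.memLp t i)
  have hx (t : ℕ) : IsUncorrelated μ (fun t ω => ω t) t fun ω => (S.optState t ω).ofLp :=
    h.isUncorrelated_state hσ (hxu 0).1 fun k _ => (hxu k).2
  have hdev (t : ℕ) : ∫ ω, S.deviation (S.optState t ω) (S.optInput t ω) ∂μ = 0 := by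
    simp [deviation, optInput]
  have hstep (t : ℕ) := h.integral_cost_add_meanValue_succ hQ hR hσ hAB (hx t) (hxu t).2
  set a : ℕ → ℝ := fun t => S.meanValue μ (S.optState t)
  have ha (t : ℕ) : 0 ≤ a t := meanValue_nonneg hQ hR hAB _
  obtain ⟨c, hc, hcontr⟩ := exists_contraction hQ hR (Pstar_posSemidef hQ hR hAB)
  have hbdd (t : ℕ) : a t ≤ a 0 + s * (1 + c) / c := by
    have := le_of_contraction_recursion (a := a) (g := fun _ => 0) hc (T := t) (ha 0) hs
      fun k _ => by
        have := h.meanValue_contraction hQ hR hσ hAB (hx k) (hxu k).2 hcontr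
        rwa [hdev] at this
    simpa using this
  have hsum (T : ℕ) : ∑ k ∈ Finset.Icc 1 T, ∫ ω, S.cost (S.optState k ω) (S.optInput k ω) ∂μ =
      a 1 - a (T + 1) + T * s := by
    induction T with
    | zero => simp
    | succ T ih =>
      rw [Finset.sum_Icc_succ_top (by omega), ih]
      have := hstep (T + 1)
      rw [hdev] at this
      push_cast
      linarith
  have hlim : Tendsto (fun T : ℕ => (a 1 - a (T + 1)) / T + s) atTop (𝓝 (0 + s)) := by
    refine Tendsto.add ?_ tendsto_const_nhds
    refine squeeze_zero_norm (a := fun T : ℕ => (a 1 + (a 0 + s * (1 + c) / c)) / T) (fun T => ?_)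
      (tendsto_const_div_atTop_nhds_zero_nat _)
    rw [norm_div, Real.norm_natCast, Real.norm_eq_abs]
    refine div_le_div_of_nonneg_right (abs_le.2 ⟨?_, ?_⟩) (Nat.cast_nonneg T)
    · linarith [hbdd (T + 1), ha 1]
    · linarith [hbdd 0, ha 0, ha (T + 1)]
  rw [zero_add] at hlim
  refine (ENNReal.tendsto_ofReal hlim).congr' ?_
  filter_upwards [eventually_gt_atTop 0] with T hT
  have hT' : (0 : ℝ) < T := by exact_mod_cast hT
  simp only [fun k => expectedCost_eq hQ hR (hxu k).1 (hxu k).2]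
  rw [← ENNReal.ofReal_sum_of_nonneg fun k _ => integral_nonneg fun ω => cost_nonneg hQ hR _ _,
    hsum, ← ENNReal.ofReal_natCast, ← ENNReal.ofReal_div_of_pos hT']
  congr 1
  field_simp

end LQR

/-! ### Extended real sums and the regret bound -/

theorem EReal.coe_sum_real {ι : Type*} (s : Finset ι) (f : ι → ℝ) :
    ((∑ i ∈ s, f i : ℝ) : EReal) = ∑ i ∈ s, (f i : EReal) :=
  map_sum (⟨⟨Real.toEReal, EReal.coe_zero⟩, EReal.coe_add⟩ : ℝ →+ EReal) f s

/-- Excluding `⊥` is essential, because `⊤ + ⊥ = ⊥` in `EReal`. -/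
theorem EReal.sum_eq_top {ι : Type*} [DecidableEq ι] {s : Finset ι} {f : ι → EReal}
    (hbot : ∀ i ∈ s, f i ≠ ⊥) {i : ι} (hi : i ∈ s) (htop : f i = ⊤) : ∑ j ∈ s, f j = ⊤ := by
  rw [← Finset.add_sum_erase s f hi, htop]
  refine EReal.top_add_of_ne_bot ?_
  refine Finset.sum_induction f (· ≠ ⊥) (fun a b ha hb => EReal.add_ne_bot_iff.2 ⟨ha, hb⟩)
    (by simp) fun j hj => hbot j (Finset.mem_of_mem_erase hj)

theorem mainTheorem3 {n p : ℕ} (hn : 0 < n) (hp : 0 < p) (S : LQR n p)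
    (hQ : S.Q.PosDef) (hR : S.R.PosDef) (hσ : 0 ≤ S.noiseVar)
    (hAB : IsControllable S.A S.B) :
    ∃ (T₀ : ℕ) (C₀ : ℝ), 0 < T₀ ∧ 0 < C₀ ∧
      ∀ {Ω : Type*} [MeasurableSpace Ω] (μ : Measure Ω) [IsProbabilityMeasure μ]
        (x : ℕ → Ω → EuclideanSpace ℝ (Fin n)) (u : ℕ → Ω → EuclideanSpace ℝ (Fin p))
        (w : ℕ → Ω → EuclideanSpace ℝ (Fin n)),
        S.IsTrajectory μ (multivariateGaussian 0 S.Pinf) x u w →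
        ∀ (δ : ℝ) (f : ℝ → ℝ), 0 ≤ δ → δ ≤ 1 →
          (∀ T : ℕ, 1 - δ ≤ μ.real {ω | f T ≤ lambdaMin (empiricalCov x u T ω)}) →
          ∀ T : ℕ, T₀ ≤ T →
            ((1 / 2 * (1 - δ) * lambdaMin S.R * (1 + sigmaMin S.Kstar ^ 2) *
                f ((T : ℝ) - (T₀ : ℝ)) - C₀ : ℝ) : EReal) ≤ S.expectedRegret μ x u T := by
  obtain ⟨c, hc, hcontr⟩ :=
    LQR.exists_contraction hQ hR (LQR.Pstar_posSemidef hQ hR hAB)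
  set s := S.noiseVar * S.Pstar.trace
  have hs : 0 ≤ s := LQR.noiseVar_mul_trace_nonneg hQ hR hσ hAB
  obtain ⟨N, hN⟩ := pow_unbounded_of_one_lt (2 : ℝ) (by linarith : 1 < 1 + c)
  have hN' : 2 ≤ (1 + c) ^ (N + 1) :=
    hN.le.trans (pow_le_pow_right₀ (by linarith) N.le_succ)
  -- Both additions of 1 secure positivity: `N` and `s` may be 0.
  refine ⟨N + 1, s * (1 + c) / c + 1, N.succ_pos, by positivity, ?_⟩
  intro Ω _ μ _ x u w h δ f _ hδ hf T hT
  obtain ⟨j, hj, hjs⟩ : ∃ j : ℝ, (S.Jstar : EReal) = j ∧ j ≤ s := by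
    have hJ := LQR.Jstar_le hQ hR hσ hAB
    refine ⟨S.Jstar.toReal, ?_, ENNReal.toReal_le_of_le_ofReal hs hJ⟩
    rw [EReal.coe_ennreal_toReal (hJ.trans_lt ENNReal.ofReal_lt_top).ne]
  -- If some expected cost is infinite, the regret is `⊤`, because J⋆ is finite.
  by_cases hfin : ∀ k ∈ Finset.range (T + 1), S.expectedCost μ (x k) (u k) ≠ ∞
  swap
  · push Not at hfin
    obtain ⟨k, hk, hk'⟩ := hfin
    have htop : S.expectedRegret μ x u T = ⊤ := by
      refine EReal.sum_eq_top (fun i _ => ?_) hk ?_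
      · rw [hj, sub_eq_add_neg, ← EReal.coe_neg, EReal.add_ne_bot_iff]
        exact ⟨EReal.coe_ennreal_ne_bot _, EReal.coe_ne_bot _⟩
      · rw [hk', hj, EReal.coe_ennreal_top, EReal.top_sub_coe]
    rw [htop]
    exact le_top
  have hL2 (k : ℕ) (hk : k ≤ T) := LQR.memLp_two_of_expectedCost_ne_top hQ hR
    (h.measurable_state k) (h.measurable_input k)
    (hfin k (Finset.mem_range.2 (Nat.lt_succ_of_le hk)))
  have hx (k : ℕ) (hk : k ≤ T) : IsUncorrelated μ w k fun ω => (x k ω).ofLp :=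
    h.isUncorrelated_state hσ (hL2 0 T.zero_le).1 fun i hi => (hL2 i (by omega)).2
  set a : ℕ → ℝ := fun k => S.meanValue μ (x k)
  set g : ℕ → ℝ := fun k => ∫ ω, S.deviation (x k ω) (u k ω) ∂μ
  have hcost (k : ℕ) (hk : k ≤ T) :
      ∫ ω, S.cost (x k ω) (u k ω) ∂μ = a k - a (k + 1) + g k + s := by
    have := h.integral_cost_add_meanValue_succ hQ hR hσ hAB (hx k hk) (hL2 k hk).2
    linarith
  have hregret : S.expectedRegret μ x u T =
      ((∑ k ∈ Finset.range (T + 1), (a k - a (k + 1) + g k + s - j) : ℝ) : EReal) := by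
    rw [LQR.expectedRegret, hj, EReal.coe_sum_real]
    refine Finset.sum_congr rfl fun k hk => ?_
    have hk : k ≤ T := Nat.lt_succ_iff.1 (Finset.mem_range.1 hk)
    rw [LQR.expectedCost_eq hQ hR (hL2 k hk).1 (hL2 k hk).2, EReal.coe_ennreal_ofReal,
      max_eq_left (integral_nonneg fun ω => LQR.cost_nonneg hQ hR _ _), hcost k hk,
      EReal.coe_sub]
  rw [hregret, EReal.coe_le_coe_iff]
  have hgron := half_sum_le_of_contraction_recursion (a := a) (g := g) hc hN'
    (LQR.meanValue_nonneg hQ hR hAB _) hs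
    (fun k _ => integral_nonneg fun ω => LQR.deviation_nonneg hQ hR hAB _ _)
    (fun k hk => h.meanValue_contraction hQ hR hσ hAB (hx k hk) (hL2 k hk).2 hcontr)
  have hexc := LQR.excitation_le_sum_integral_deviation hn hp hQ hR hAB (N := T - (N + 1))
    (fun k hk => (hL2 k (by omega)).1) (fun k hk => (hL2 k (by omega)).2) hδ (hf (T - (N + 1)))
  rw [Nat.cast_sub hT] at hexc
  -- Replacing J⋆ by the larger `s` lowers each term; the sum then telescopes.
  have htel : ∑ k ∈ Finset.range (T + 1), (a k - a (k + 1) + g k) ≤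
      ∑ k ∈ Finset.range (T + 1), (a k - a (k + 1) + g k + s - j) :=
    Finset.sum_le_sum fun k _ => by linarith
  rw [Finset.sum_add_distrib, Finset.sum_range_sub'] at htel
  linarith
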